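/- A \emph{circle} in $\mathbb{R}^2$ is a circle or a straight line together with a choice of one of the two components of its complement, called its interior. Two circles are \emph{tangent} if their interiors are disjoint and the curves meet in exactly one point of $\mathbb{R}^2\cup\{\infty\}$ (so two distinct parallel lines are tangent at infinity). For a triple $T$ of mutually tangent circles, the \emph{Apollonian circle packing generated by $T$} is $\bigcup_{n\ge 0}\mathcal{P}^{(n)}$, where $\mathcal{P}^{(0)}=T$ and $\mathcal{P}^{(n+1)}$ consists of $\mathcal{P}^{(n)}$ together with all circles that are tangent to three mutually tangent circles of $\mathcal{P}^{(n)}$. For $\alpha>0$ let $\mathcal{P}_\alpha$ be the packing generated by $\{X_\alpha,Y_\alpha,L\}$, where $L$ is the $x$-axis with the lower half-plane as interior, $X_\alpha$ is the circle of curvature $\alpha^2$ tangent to $L$ from above at the origin, and $Y_\alpha$ is the circle of curvature $1$ tangent to $L$ from above and tangent to $X_\alpha$ on the right. For two circles of $\mathcal{P}_\alpha$ tangent to $L$, write $C\prec D$ if the point of tangency of $C$ with $L$ lies to the left of that of $D$; for a line parallel to $L$ this point counts as $-\infty$. The circles of $\mathcal{P}_\alpha$ tangent to $L$ are labelled recursively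 by pairs of integers: $X_\alpha$ has label $(1,0)$, $Y_\alpha$ has label $(0,1)$, and whenever $C_1\prec C_2\prec C_3$ are mutually tangent, the label of $C_2$ is the sum of the labels of $C_1$ and $C_3$. A \emph{similarity} is a map $\Phi:\mathbb{R}^2\to\mathbb{R}^2$ of the form $\Phi(x)=\mu Ax+b$ with $\mu>0$, $A$ orthogonal and $b\in\mathbb{R}^2$; it is \emph{orientation-preserving} if $\det A=1$. It maps $\mathcal{P}$ to $\mathcal{P}'$ if $\mathcal{P}'=\{\Phi(C):C\in\mathcal{P}\}$, and two packings are \emph{similar} (resp. similar via an orientation-preserving similarity) if some similarity (resp. some orientation-preserving similarity) maps the first to the second. \textbf{Theorem.} Let $\alpha,\beta>0$. For every similarity $\Phi$ that preserves the $x$-axis and maps $\mathcal{P}_\beta$ to $\mathcal{P}_\alpha$, the circles $\Phi(X_\beta)$ and $\Phi(Y_\beta)$ of $\mathcal{P}_\alpha$ have unique labels $(a,b)$ and $(c,d)$, and the matrix $\begin{bmatrix}a&b\\c&d\end{bmatrix}$ lies in $\operatorname{GL}_2(\mathbb{Z})$. Sending $\Phi$ to the class of this matrix defines a bijection from the set of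 all such similarities onto the set of elements $\begin{bmatrix}a&b\\c&d\end{bmatrix}\in\operatorname{PGL}_2(\mathbb{Z})=\operatorname{GL}_2(\mathbb{Z})/\{\pm I\}$ with \[\frac{a\alpha+b}{c\alpha+d}=\beta .\] The similarity $\Phi$ is orientation-preserving if and only if the corresponding element lies in $\operatorname{PSL}_2(\mathbb{Z})$ (the classes of matrices of determinant $1$). Moreover, $\mathcal{P}_\alpha$ and $\mathcal{P}_\beta$ are similar (resp. similar via an orientation-preserving similarity) if and only if there exist integers $a,b,c,d$ with $ad-bc=\pm1$ (resp. $ad-bc=1$) such that $\dfrac{a\alpha+b}{c\alpha+d}=\beta$. -/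

import Mathlib

open scoped RealInnerProductSpace MatrixGroups

noncomputable section

namespace Apollonian

/-- The Euclidean plane `ℝ²`. -/
abbrev Plane : Type := EuclideanSpace ℝ (Fin 2)

/-- A *circle*: a circle or a straight line in the plane, together with a choice of one of the two
components of its complement, called its interior. -/
@[ext]
structure Circle where
  /-- the curve itself -/
  carrier : Set Plane
  /-- the chosen component of the complement of the curve -/
  interior : Set Plane
  spec :
    (∃ (c : Plane) (r : ℝ), 0 < r ∧ carrier = Metric.sphere c r ∧
      (interior = Metric.ball c r ∨ interior = (Metric.closedBall c r)ᶜ)) ∨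
    (∃ (n : Plane) (k : ℝ), n ≠ 0 ∧ carrier = {x | ⟪n, x⟫ = k} ∧ interior = {x | k < ⟪n, x⟫})

/-- The circle is a straight line. -/
def Circle.IsLine (C : Circle) : Prop :=
  ∃ (n : Plane) (k : ℝ), n ≠ 0 ∧ C.carrier = {x | ⟪n, x⟫ = k}

/-- Tangency of circles (with their chosen interiors): the interiors are disjoint, and the curves
meet in exactly one point of the plane extended by one point at infinity. For two lines the common
point is the one at infinity, so that they are disjoint (parallel) lines. -/
def Tangent (C D : Circle) : Prop :=
  Disjoint C.interior D.interior ∧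
    ((C.IsLine ∧ D.IsLine ∧ Disjoint C.carrier D.carrier) ∨
      (¬ (C.IsLine ∧ D.IsLine) ∧ ∃ p, C.carrier ∩ D.carrier = {p}))

/-- Three mutually tangent circles. -/
def MutuallyTangent (A B C : Circle) : Prop :=
  Tangent A B ∧ Tangent B C ∧ Tangent A C

/-- The stages `𝒫⁽ⁿ⁾` of the recursive construction of an Apollonian packing from a set `T`. -/
def stage (T : Set Circle) : ℕ → Set Circle
  | 0 => T
  | n + 1 => stage T n ∪ {D | ∃ A ∈ stage T n, ∃ B ∈ stage T n, ∃ C ∈ stage T n,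
      MutuallyTangent A B C ∧ Tangent D A ∧ Tangent D B ∧ Tangent D C}

/-- The Apollonian circle packing generated by `T`. -/
def packing (T : Set Circle) : Set Circle := ⋃ n, stage T n

/-- The circle with centre `c` and radius `r`, whose interior is the open disc. -/
def disc (c : Plane) (r : ℝ) (hr : 0 < r) : Circle where
  carrier := Metric.sphere c r
  interior := Metric.ball c r
  spec := Or.inl ⟨c, r, hr, rfl, Or.inl rfl⟩

/-- The line `{⟪n, x⟫ = k}` with interior `{k < ⟪n, x⟫}`. -/
def line (n : Plane) (k : ℝ) (hn : n ≠ 0) : Circle where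
  carrier := {x | ⟪n, x⟫ = k}
  interior := {x | k < ⟪n, x⟫}
  spec := Or.inr ⟨n, k, hn, rfl, rfl⟩

/-- The `x`-axis. Its interior is the lower half-plane, so that a packing containing it lies in the
upper half-plane. -/
def xAxis : Circle :=
  line !₂[(0 : ℝ), -1] 0 (fun h => by simpa using congrArg (fun v : Plane => v 1) h)

/-- The circle of curvature `α²` tangent to the `x`-axis from above at the origin. -/
def circleX (α : ℝ) (hα : 0 < α) : Circle :=
  disc !₂[(0 : ℝ), 1 / α ^ 2] (1 / α ^ 2) (by positivity)

/-- The circle of curvature `1` that lies above and is tangent to the `x`-axis, and is tangent to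
`circleX α` on the right. -/
def circleY (α : ℝ) : Circle :=
  disc !₂[2 / α, (1 : ℝ)] 1 one_pos

/-- The half-plane packing `𝒫_α`. -/
def halfPlanePacking (α : ℝ) (hα : 0 < α) : Set Circle :=
  packing {circleX α hα, circleY α, xAxis}

/-- `C ≺ D` for two circles tangent to the `x`-axis: the point of tangency of `C` with the axis is
to the left of that of `D`; for a line parallel to the axis the point of tangency counts as
`-∞`. -/
def LeftOf (C D : Circle) : Prop :=
  (C.IsLine ∧ ¬ D.IsLine) ∨
    ∃ p ∈ C.carrier ∩ xAxis.carrier, ∃ q ∈ D.carrier ∩ xAxis.carrier, p 0 < q 0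

/-- The labelling of the circles of `𝒫_α` tangent to the `x`-axis by pairs of integers:
`IsLabel α hα C v` says that `C` carries the label `v`. The two generating circles are labelled
`(1, 0)` and `(0, 1)`, and whenever three mutually tangent circles tangent to the axis satisfy
`C₁ ≺ C₂ ≺ C₃`, the label of `C₂` is the sum of those of `C₁` and `C₃`; the three recursive clauses
use this rule to label a new circle that is the middle, the left or the right one of the three. -/
inductive IsLabel (α : ℝ) (hα : 0 < α) : Circle → ℤ × ℤ → Prop
  | baseX : IsLabel α hα (circleX α hα) (1, 0)
  | baseY : IsLabel α hα (circleY α) (0, 1)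
  | middle {A B C : Circle} {v w : ℤ × ℤ} : IsLabel α hα A v → IsLabel α hα B w →
      MutuallyTangent A B C → Tangent C xAxis → LeftOf A C → LeftOf C B →
      IsLabel α hα C (v + w)
  | left {A B C : Circle} {v w : ℤ × ℤ} : IsLabel α hα A v → IsLabel α hα B w →
      MutuallyTangent A B C → Tangent C xAxis → LeftOf C A → LeftOf A B →
      IsLabel α hα C (v - w)
  | right {A B C : Circle} {v w : ℤ × ℤ} : IsLabel α hα A v → IsLabel α hα B w →
      MutuallyTangent A B C → Tangent C xAxis → LeftOf A B → LeftOf B C →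
      IsLabel α hα C (w - v)

/-! ### Similarities -/

/-- A similarity (`Φ : Plane ≃ᵈ Plane`, a bijection multiplying all distances by one positive
constant) is orientation-preserving if it has the form `x ↦ μ A x + b` with `μ > 0` and `A` an
orthogonal matrix of determinant `1`. -/
def OrientationPreserving (Φ : Plane ≃ᵈ Plane) : Prop :=
  ∃ μ : ℝ, 0 < μ ∧ ∃ A ∈ Matrix.specialOrthogonalGroup (Fin 2) ℝ, ∃ b : Plane,
    ∀ x, Φ x = μ • Matrix.toEuclideanLin A x + b

theorem dist_lt_dist_iff (p n x : Plane) :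
    dist x (p + n) < dist x (p - n) ↔ ⟪n, p⟫ < ⟪n, x⟫ := by
  rw [dist_eq_norm, dist_eq_norm, ← sq_lt_sq₀ (norm_nonneg _) (norm_nonneg _),
    show x - (p + n) = (x - p) - n by abel, show x - (p - n) = (x - p) + n by abel,
    norm_sub_sq_real, norm_add_sq_real, real_inner_comm, inner_sub_right]
  constructor <;> intro h <;> linarith

theorem dist_eq_dist_iff (p n x : Plane) :
    dist x (p + n) = dist x (p - n) ↔ ⟪n, x⟫ = ⟪n, p⟫ := by
  rw [dist_eq_norm, dist_eq_norm, ← sq_eq_sq₀ (norm_nonneg _) (norm_nonneg _),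
    show x - (p + n) = (x - p) - n by abel, show x - (p - n) = (x - p) + n by abel,
    norm_sub_sq_real, norm_add_sq_real, real_inner_comm, inner_sub_right]
  constructor <;> intro h <;> linarith

theorem image_setOf_dist (Φ : Plane ≃ᵈ Plane) (P : ℝ → Prop) (Q : ℝ → Prop) (c : Plane)
    (h : ∀ t, P t ↔ Q (Dilation.ratio Φ * t)) :
    Φ '' {x | P (dist x c)} = {y | Q (dist y (Φ c))} := by
  ext y
  obtain ⟨x, rfl⟩ := Φ.surjective y
  simp [Φ.injective.eq_iff, h, Dilation.dist_eq]

/-- The image of a circle under a similarity is a circle. -/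
theorem image_spec (Φ : Plane ≃ᵈ Plane) (C : Circle) :
    (∃ (c : Plane) (r : ℝ), 0 < r ∧ Φ '' C.carrier = Metric.sphere c r ∧
      (Φ '' C.interior = Metric.ball c r ∨ Φ '' C.interior = (Metric.closedBall c r)ᶜ)) ∨
    (∃ (n : Plane) (k : ℝ), n ≠ 0 ∧ Φ '' C.carrier = {x | ⟪n, x⟫ = k} ∧
      Φ '' C.interior = {x | k < ⟪n, x⟫}) := by
  have hm : (0 : ℝ) < Dilation.ratio Φ := by exact_mod_cast Dilation.ratio_pos Φ
  rcases C.spec with ⟨c, r, hr, hc, hi⟩ | ⟨n, k, hn, hc, hi⟩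
  · refine Or.inl ⟨Φ c, Dilation.ratio Φ * r, mul_pos hm hr, ?_, ?_⟩
    · rw [hc]
      exact image_setOf_dist Φ (· = r) (· = Dilation.ratio Φ * r) c
        fun t => (mul_right_inj' hm.ne').symm
    · refine hi.imp (fun hi => ?_) (fun hi => ?_)
      · rw [hi]
        exact image_setOf_dist Φ (· < r) (· < Dilation.ratio Φ * r) c
          fun t => (mul_lt_mul_iff_right₀ hm).symm
      · rw [hi]
        exact image_setOf_dist Φ (¬ · ≤ r) (¬ · ≤ Dilation.ratio Φ * r) c
          fun t => (mul_le_mul_iff_right₀ hm).not.symm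
  · -- a half-plane is the set of points nearer to one point than to another
    have hp : ⟪n, (k / ⟪n, n⟫) • n⟫ = k := by
      rw [inner_smul_right, div_mul_cancel₀ _ (inner_self_ne_zero.mpr hn)]
    set p : Plane := (k / ⟪n, n⟫) • n with hpdef
    let a := Φ (p + n)
    let b := Φ (p - n)
    let q : Plane := (2⁻¹ : ℝ) • (a + b)
    let m : Plane := (2⁻¹ : ℝ) • (a - b)
    have ha : q + m = a := by simp only [q, m]; module
    have hb : q - m = b := by simp only [q, m]; module
    refine Or.inr ⟨m, ⟪m, q⟫, ?_, ?_, ?_⟩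
    · intro h0
      have hab : a = b := by rw [← ha, ← hb, h0]; simp
      have h2 := Φ.injective hab
      apply hn
      have h3 : (2 : ℝ) • n = 0 := by
        have : (2 : ℝ) • n = (p + n) - (p - n) := by module
        rw [this, h2, sub_self]
      exact (smul_eq_zero.mp h3).resolve_left two_ne_zero
    · rw [hc]
      ext y
      obtain ⟨x, rfl⟩ := Φ.surjective y
      rw [Φ.injective.mem_set_image, Set.mem_ofPred_eq, Set.mem_ofPred_eq, ← dist_eq_dist_iff q m,
        ha, hb, Dilation.dist_eq Φ, Dilation.dist_eq Φ, mul_right_inj' hm.ne', dist_eq_dist_iff, hp]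
    · rw [hi]
      ext y
      obtain ⟨x, rfl⟩ := Φ.surjective y
      rw [Φ.injective.mem_set_image, Set.mem_ofPred_eq, Set.mem_ofPred_eq, ← dist_lt_dist_iff q m,
        ha, hb, Dilation.dist_eq Φ, Dilation.dist_eq Φ, mul_lt_mul_iff_right₀ hm, dist_lt_dist_iff,
        hp]

/-- The image `Φ(C)` of a circle under a similarity. -/
def Circle.map (Φ : Plane ≃ᵈ Plane) (C : Circle) : Circle where
  carrier := Φ '' C.carrier
  interior := Φ '' C.interior
  spec := image_spec Φ C

/-- `Φ · 𝒫 = {Φ(C) : C ∈ 𝒫}`. -/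
def mapPacking (Φ : Plane ≃ᵈ Plane) (P : Set Circle) : Set Circle := Circle.map Φ '' P

/-- Two packings are similar. -/
def Similar (P Q : Set Circle) : Prop := ∃ Φ : Plane ≃ᵈ Plane, mapPacking Φ P = Q

/-- Two packings are similar via an orientation-preserving similarity. -/
def OrientedSimilar (P Q : Set Circle) : Prop :=
  ∃ Φ : Plane ≃ᵈ Plane, OrientationPreserving Φ ∧ mapPacking Φ P = Q

/-- The similarities of the plane that preserve the `x`-axis and map `𝒫_β` to `𝒫_α`. -/
def axisSimilarities (α β : ℝ) (hα : 0 < α) (hβ : 0 < β) : Set (Plane ≃ᵈ Plane) :=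
  {Φ | Φ '' xAxis.carrier = xAxis.carrier ∧
    mapPacking Φ (halfPlanePacking β hβ) = halfPlanePacking α hα}

/-- The elements `[a b; c d]` of `PGL₂(ℤ)` with `(a α + b) / (c α + d) = β`. -/
def moebiusElements (α β : ℝ) : Set PGL(2, ℤ) :=
  {g | ∃ M : GL (Fin 2) ℤ, Matrix.ProjGenLinGroup.mk M = g ∧
    ((M 0 0 : ℝ) * α + (M 0 1 : ℝ)) / ((M 1 0 : ℝ) * α + (M 1 1 : ℝ)) = β}

/-- `N = [a b; c d]` is a label matrix of `Φ`: the generating circles of `𝒫_β` with labels `(1, 0)`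
and `(0, 1)` are mapped by `Φ` to circles of `𝒫_α` with labels `(a, b)` and `(c, d)`. -/
def IsLabelMatrix (α β : ℝ) (hα : 0 < α) (hβ : 0 < β) (Φ : Plane ≃ᵈ Plane)
    (N : Matrix (Fin 2) (Fin 2) ℤ) : Prop :=
  IsLabel α hα ((circleX β hβ).map Φ) (N 0 0, N 0 1) ∧
    IsLabel α hα ((circleY β).map Φ) (N 1 0, N 1 1)

end Apollonian

end

/-! A circle with a chosen interior is a unit vector (curvature, co-curvature, curvature times
centre) of a Lorentzian space. Two circles are tangent exactly when the form of their vectors is −1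
and the sum of the vectors, which is then null, points to the future (`Represents.tangent_iff`).

The vectors of circles tangent to the axis are quadratic in two real parameters (s, t): s² is the
curvature and t/s the point of tangency, as for Ford circles. Two of them are tangent exactly when
the determinant of their parameters is ±2, and the sign of the determinant decides ≺. Choosing one
of ±(s, t) makes the labelling rule plain addition: the label (a, b) stands for a(α, 0) + b(1, 2/α).
Hence labels are unique, and those that occur are the coprime pairs, one from each pair ±v.

It remains to see that the packing has no further circles on the axis. Four mutually tangent circles
form a basis, and each can be swapped for the other circle tangent to the remaining three. A growth
estimate along reduced sequences of swaps (`mem_orbit_or_le`) shows that a circle of the orbit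
tangent to a member of a quadruple is reached without swapping that member. So three mutually
tangent circles of the orbit lie in one quadruple, the orbit is closed under the rule that generates
the packing, and circles tangent to the axis come from quadruples with labels v, w, v + w and
determinant ±1 (`exists_label_of_mem`).

A similarity that preserves the axis sends `X_β` and `Y_β` to tangent circles on the axis, hence to
labels (a, b), (c, d) of determinant ±1; comparing curvatures gives aα + b = β(cα + d). Conversely
the labels determine the similarity, and any such matrix, with the sign making cα + d positive, is
realised by an explicit map (`exists_axisSimilarity`). It carries one packing onto the other because
each packing is generated from any basis of labels together with the axis. The determinant is 1
exactly when left and right are kept. If a similarity moves the axis, both packings contain a second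
line, so α and β are rational and already equivalent under SL₂(ℤ). -/

noncomputable section

namespace Apollonian

/-! ### Circles as unit vectors of a Lorentzian space -/

/-- The Lorentzian form on the space of vectors `(κ, κ', X, Y)`. -/
def form (v w : Fin 4 → ℝ) : ℝ := v 2 * w 2 + v 3 * w 3 - (v 0 * w 1 + v 1 * w 0) / 2

/-- The quadratic function on the plane attached to a vector: it is negative in the interior of the
circle of curvature `κ` and zero on the curve. -/
def quadric (v : Fin 4 → ℝ) (z : Plane) : ℝ :=
  v 0 * (z 0 ^ 2 + z 1 ^ 2) - 2 * (v 2 * z 0 + v 3 * z 1) + v 1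

/-- The unit vector `v` represents the circle `C`. -/
def Represents (C : Circle) (v : Fin 4 → ℝ) : Prop :=
  form v v = 1 ∧ C.carrier = {z | quadric v z = 0} ∧ C.interior = {z | quadric v z < 0}

theorem form_comm (v w : Fin 4 → ℝ) : form v w = form w v := by unfold form; ring

theorem form_add_left (u v w : Fin 4 → ℝ) : form (u + v) w = form u w + form v w := by
  simp only [form, Pi.add_apply]; ring

theorem form_smul_left (a : ℝ) (v w : Fin 4 → ℝ) : form (a • v) w = a * form v w := by
  simp only [form, Pi.smul_apply, smul_eq_mul]; ring

theorem form_neg_left (v w : Fin 4 → ℝ) : form (-v) w = -form v w := by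
  simp only [form, Pi.neg_apply]; ring

theorem quadric_add (v w : Fin 4 → ℝ) (z : Plane) :
    quadric (v + w) z = quadric v z + quadric w z := by
  simp only [quadric, Pi.add_apply]; ring

theorem quadric_neg (v : Fin 4 → ℝ) (z : Plane) : quadric (-v) z = -quadric v z := by
  simp only [quadric, Pi.neg_apply]; ring

theorem dist_sq_eq (z c : Plane) : dist z c ^ 2 = (z 0 - c 0) ^ 2 + (z 1 - c 1) ^ 2 := by
  rw [EuclideanSpace.dist_eq, Real.sq_sqrt (by positivity)]
  simp [Fin.sum_univ_two, Real.dist_eq, sq_abs]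

theorem inner_plane (n z : Plane) : ⟪n, z⟫ = n 0 * z 0 + n 1 * z 1 := by
  simp [PiLp.inner_apply, Fin.sum_univ_two]; ring

theorem plane_ext {z w : Plane} (h0 : z 0 = w 0) (h1 : z 1 = w 1) : z = w := by
  ext i; fin_cases i
  · exact h0
  · exact h1

/-- The vector of the disc of centre `c` and radius `r`. -/
def discVec (c : Plane) (r : ℝ) : Fin 4 → ℝ :=
  ![1 / r, (c 0 ^ 2 + c 1 ^ 2 - r ^ 2) / r, c 0 / r, c 1 / r]

theorem form_discVec (c : Plane) {r : ℝ} (hr : r ≠ 0) : form (discVec c r) (discVec c r) = 1 := by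
  simp [form, discVec]; field_simp; ring

theorem quadric_discVec (c z : Plane) {r : ℝ} (hr : r ≠ 0) :
    quadric (discVec c r) z = (dist z c ^ 2 - r ^ 2) / r := by
  rw [dist_sq_eq]; simp [quadric, discVec]; field_simp; ring

theorem quadric_discVec_eq_zero (c z : Plane) {r : ℝ} (hr : 0 < r) :
    quadric (discVec c r) z = 0 ↔ dist z c = r := by
  rw [quadric_discVec c z hr.ne', div_eq_zero_iff, or_iff_left hr.ne', sub_eq_zero,
    sq_eq_sq₀ dist_nonneg hr.le]

theorem quadric_discVec_neg (c z : Plane) {r : ℝ} (hr : 0 < r) :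
    quadric (discVec c r) z < 0 ↔ dist z c < r := by
  rw [quadric_discVec c z hr.ne', div_lt_iff₀ hr, zero_mul, sub_neg,
    sq_lt_sq₀ dist_nonneg hr.le]

theorem quadric_discVec_pos (c z : Plane) {r : ℝ} (hr : 0 < r) :
    0 < quadric (discVec c r) z ↔ r < dist z c := by
  rw [quadric_discVec c z hr.ne', lt_div_iff₀ hr, zero_mul, sub_pos,
    sq_lt_sq₀ hr.le dist_nonneg]

theorem represents_ball {C : Circle} {c : Plane} {r : ℝ} (hr : 0 < r)
    (h1 : C.carrier = Metric.sphere c r) (h2 : C.interior = Metric.ball c r) :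
    Represents C (discVec c r) := by
  refine ⟨form_discVec c hr.ne', ?_, ?_⟩
  · ext z; rw [h1, Metric.mem_sphere, Set.mem_ofPred_eq, quadric_discVec_eq_zero c z hr]
  · ext z; rw [h2, Metric.mem_ball, Set.mem_ofPred_eq, quadric_discVec_neg c z hr]

theorem represents_exterior {C : Circle} {c : Plane} {r : ℝ} (hr : 0 < r)
    (h1 : C.carrier = Metric.sphere c r) (h2 : C.interior = (Metric.closedBall c r)ᶜ) :
    Represents C (-discVec c r) := by
  refine ⟨?_, ?_, ?_⟩
  · rw [form_neg_left, form_comm, form_neg_left, form_discVec c hr.ne', neg_neg]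
  · ext z
    rw [h1, Metric.mem_sphere, Set.mem_ofPred_eq, quadric_neg, neg_eq_zero,
      quadric_discVec_eq_zero c z hr]
  · ext z; simp [h2, quadric_neg, quadric_discVec_pos c z hr]

theorem represents_line {C : Circle} {n : Plane} {k : ℝ} (hn : n ≠ 0)
    (h1 : C.carrier = {x | ⟪n, x⟫ = k}) (h2 : C.interior = {x | k < ⟪n, x⟫}) :
    ∃ v, Represents C v ∧ v 0 = 0 := by
  have hpos : 0 < ‖n‖ := norm_pos_iff.mpr hn
  have hsq : ‖n‖ ^ 2 = n 0 ^ 2 + n 1 ^ 2 := by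
    rw [← dist_zero_right, dist_sq_eq]; simp
  have key : ∀ z : Plane, quadric ![0, 2 * k / ‖n‖, n 0 / ‖n‖, n 1 / ‖n‖] z
      = 2 * (k - ⟪n, z⟫) / ‖n‖ := by
    intro z; rw [inner_plane]; simp [quadric]; ring
  refine ⟨![0, 2 * k / ‖n‖, n 0 / ‖n‖, n 1 / ‖n‖], ⟨?_, ?_, ?_⟩, rfl⟩
  · simp [form]; field_simp; rw [hsq]
  · ext z
    rw [h1, Set.mem_ofPred_eq, Set.mem_ofPred_eq, key, div_eq_zero_iff, or_iff_left hpos.ne']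
    constructor <;> intro h <;> linarith
  · ext z
    rw [h2, Set.mem_ofPred_eq, Set.mem_ofPred_eq, key, div_lt_iff₀ hpos]
    constructor <;> intro h <;> linarith

theorem exists_represents (C : Circle) : ∃ v, Represents C v := by
  rcases C.spec with ⟨c, r, hr, h1, h2 | h2⟩ | ⟨n, k, hn, h1, h2⟩
  · exact ⟨_, represents_ball hr h1 h2⟩
  · exact ⟨_, represents_exterior hr h1 h2⟩
  · exact (represents_line hn h1 h2).imp fun _ h => h.1

theorem eq_discVec {v : Fin 4 → ℝ} (hv : form v v = 1) (h0 : v 0 ≠ 0) :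
    v = discVec !₂[v 2 / v 0, v 3 / v 0] (1 / v 0) := by
  have h : v 2 ^ 2 + v 3 ^ 2 - 1 = v 0 * v 1 := by unfold form at hv; linarith
  ext i; fin_cases i
  · simp [discVec]
  · simp [discVec]; field_simp; linarith
  · simp [discVec]; field_simp
  · simp [discVec]; field_simp

theorem exists_circle {v : Fin 4 → ℝ} (hv : form v v = 1) : ∃ C, Represents C v := by
  rcases lt_trichotomy (v 0) 0 with h | h | h
  · have hv' : form (-v) (-v) = 1 := by
      rw [form_neg_left, form_comm, form_neg_left, hv, neg_neg]
    have h' : 0 < (-v) 0 := by simpa using h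
    have hr : 0 < 1 / (-v) 0 := one_div_pos.mpr h'
    have := represents_exterior
      (C := ⟨_, _, Or.inl ⟨!₂[(-v) 2 / (-v) 0, (-v) 3 / (-v) 0], _, hr, rfl, Or.inr rfl⟩⟩)
      hr rfl rfl
    rw [← eq_discVec hv' h'.ne', neg_neg] at this
    exact ⟨_, this⟩
  · have hn : (!₂[v 2, v 3] : Plane) ≠ 0 := by
      intro h0
      have h2 : v 2 = 0 := by simpa using congrArg (fun z : Plane => z 0) h0
      have h3 : v 3 = 0 := by simpa using congrArg (fun z : Plane => z 1) h0
      simp [form, h, h2, h3] at hv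
    refine ⟨line !₂[v 2, v 3] (v 1 / 2) hn, hv, ?_, ?_⟩ <;> ext z <;>
      simp only [line, quadric, inner_plane, h, Set.mem_ofPred_eq] <;>
      constructor <;> intro h <;> simp at h ⊢ <;> linarith
  · have hr : 0 < 1 / v 0 := one_div_pos.mpr h
    refine ⟨disc !₂[v 2 / v 0, v 3 / v 0] (1 / v 0) hr, ?_⟩
    have := represents_ball (C := disc !₂[v 2 / v 0, v 3 / v 0] (1 / v 0) hr) hr rfl rfl
    rwa [← eq_discVec hv h.ne'] at this

theorem Represents.circle_eq {C D : Circle} {v : Fin 4 → ℝ} (hC : Represents C v)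
    (hD : Represents D v) : C = D :=
  Circle.ext (hC.2.1.trans hD.2.1.symm) (hC.2.2.trans hD.2.2.symm)

/-- If the interiors of two circles through `p` are disjoint, then the sum of their vectors is a
multiple of the null vector of `p`. -/
theorem add_eq_of_disjoint {v w : Fin 4 → ℝ} (hv : form v v = 1) (hw : form w w = 1) {p : Plane}
    (hvp : quadric v p = 0) (hwp : quadric w p = 0)
    (hd : ∀ z, quadric v z < 0 → ¬ quadric w z < 0) :
    v 2 + w 2 = (v 0 + w 0) * p 0 ∧ v 3 + w 3 = (v 0 + w 0) * p 1 ∧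
      v 1 + w 1 = (v 0 + w 0) * (p 0 ^ 2 + p 1 ^ 2) := by
  -- (a, b) and (c, d) are the unit normals at p pointing into the two interiors.
  obtain ⟨a, ha⟩ : ∃ a, a = v 2 - v 0 * p 0 := ⟨_, rfl⟩
  obtain ⟨b, hb⟩ : ∃ b, b = v 3 - v 0 * p 1 := ⟨_, rfl⟩
  obtain ⟨c, hc⟩ : ∃ c, c = w 2 - w 0 * p 0 := ⟨_, rfl⟩
  obtain ⟨d, hd'⟩ : ∃ d, d = w 3 - w 0 * p 1 := ⟨_, rfl⟩
  have hn : a ^ 2 + b ^ 2 = 1 := by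
    unfold form at hv; unfold quadric at hvp; subst ha hb; linear_combination hv + v 0 * hvp
  have hm : c ^ 2 + d ^ 2 = 1 := by
    unfold form at hw; unfold quadric at hwp; subst hc hd'; linear_combination hw + w 0 * hwp
  have hs : a + c = 0 ∧ b + d = 0 := by
    by_contra hne
    have hpos : 0 < (a + c) ^ 2 + (b + d) ^ 2 := by
      rcases not_and_or.mp hne with h | h
      · have := sq_pos_of_ne_zero h; positivity
      · have := sq_pos_of_ne_zero h; positivity
    have hE : (a + c) ^ 2 + (b + d) ^ 2 = 2 * (1 + a * c + b * d) := by linear_combination hn + hm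
    obtain ⟨m, hm'⟩ : ∃ m, m = 1 + a * c + b * d := ⟨_, rfl⟩
    have hmpos : 0 < m := by linarith
    -- A short step from p along the sum of the inward normals enters both interiors; the bound on t
    -- keeps the quadratic term below the linear one.
    obtain ⟨t, ht0, hv', hw'⟩ : ∃ t : ℝ, 0 < t ∧ v 0 * t < 1 ∧ w 0 * t < 1 := by
      refine ⟨1 / (1 + |v 0| + |w 0|), by positivity, ?_, ?_⟩
      · rw [mul_one_div, div_lt_one (by positivity)]
        linarith [le_abs_self (v 0), abs_nonneg (w 0)]
      · rw [mul_one_div, div_lt_one (by positivity)]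
        linarith [le_abs_self (w 0), abs_nonneg (v 0)]
    have e1 : quadric v !₂[p 0 + t * (a + c), p 1 + t * (b + d)] = 2 * t * m * (v 0 * t - 1) := by
      unfold quadric at hvp ⊢
      simp only [Matrix.cons_val_zero, Matrix.cons_val_one]
      subst hm'
      linear_combination hvp + v 0 * t ^ 2 * hE - 2 * t * hn + 2 * t * (a + c) * ha
        + 2 * t * (b + d) * hb
    have e2 : quadric w !₂[p 0 + t * (a + c), p 1 + t * (b + d)] = 2 * t * m * (w 0 * t - 1) := by
      unfold quadric at hwp ⊢
      simp only [Matrix.cons_val_zero, Matrix.cons_val_one]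
      subst hm'
      linear_combination hwp + w 0 * t ^ 2 * hE - 2 * t * hm + 2 * t * (a + c) * hc
        + 2 * t * (b + d) * hd'
    refine hd !₂[p 0 + t * (a + c), p 1 + t * (b + d)] ?_ ?_
    · rw [e1]; exact mul_neg_of_pos_of_neg (by positivity) (by linarith)
    · rw [e2]; exact mul_neg_of_pos_of_neg (by positivity) (by linarith)
  have h2 : v 2 + w 2 = (v 0 + w 0) * p 0 := by linear_combination hs.1 - ha - hc
  have h3 : v 3 + w 3 = (v 0 + w 0) * p 1 := by linear_combination hs.2 - hb - hd'
  refine ⟨h2, h3, ?_⟩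
  unfold quadric at hvp hwp
  linear_combination hvp + hwp + 2 * p 0 * h2 + 2 * p 1 * h3

/-- The curve of a unit vector has two points. -/
theorem exists_two_points {v : Fin 4 → ℝ} (hv : form v v = 1) :
    ∃ p p' : Plane, quadric v p = 0 ∧ quadric v p' = 0 ∧ 0 < (p' 0 - p 0) ^ 2 + (p' 1 - p 1) ^ 2 := by
  unfold form at hv
  by_cases h0 : v 0 = 0
  · have hv' : v 2 ^ 2 + v 3 ^ 2 = 1 := by rw [h0] at hv; linarith
    refine ⟨!₂[v 1 / 2 * v 2, v 1 / 2 * v 3], !₂[v 1 / 2 * v 2 - v 3, v 1 / 2 * v 3 + v 2], ?_, ?_,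
      ?_⟩
    · simp [quadric, h0]; linear_combination -v 1 * hv'
    · simp [quadric, h0]; linear_combination -v 1 * hv'
    · simp; linarith
  · refine ⟨!₂[(v 2 - 1) / v 0, v 3 / v 0], !₂[(v 2 + 1) / v 0, v 3 / v 0], ?_, ?_, ?_⟩
    · simp [quadric]; field_simp; linarith
    · simp [quadric]; field_simp; linarith
    · have : (v 2 + 1) / v 0 - (v 2 - 1) / v 0 = 2 / v 0 := by ring
      simp [this]; positivity

theorem quadric_of_add_eq {u : Fin 4 → ℝ} {p : Plane} (h2 : u 2 = u 0 * p 0)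
    (h3 : u 3 = u 0 * p 1) (h1 : u 1 = u 0 * (p 0 ^ 2 + p 1 ^ 2)) (z : Plane) :
    quadric u z = u 0 * ((z 0 - p 0) ^ 2 + (z 1 - p 1) ^ 2) := by
  unfold quadric; rw [h1, h2, h3]; ring

/-- The interior of v is disjoint from that of −w, the other side of the same curve. So v − w is a
multiple of the null vector of one point of the curve, and vanishing at a second point makes the
multiple zero. -/
theorem Represents.vec_eq {C : Circle} {v w : Fin 4 → ℝ} (hv : Represents C v)
    (hw : Represents C w) : v = w := by
  have hc : ∀ z, quadric v z = 0 ↔ quadric w z = 0 := fun z =>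
    Set.ext_iff.mp (hv.2.1.symm.trans hw.2.1) z
  have hi : ∀ z, quadric v z < 0 ↔ quadric w z < 0 := fun z =>
    Set.ext_iff.mp (hv.2.2.symm.trans hw.2.2) z
  obtain ⟨p, p', hp, hp', hne⟩ := exists_two_points hv.1
  have hw' : form (-w) (-w) = 1 := by
    rw [form_neg_left, form_comm, form_neg_left, hw.1, neg_neg]
  obtain ⟨h2, h3, h1⟩ := add_eq_of_disjoint hv.1 hw' hp
    (by rw [quadric_neg, (hc p).mp hp, neg_zero])
    (fun z hz => by rw [quadric_neg]; have := (hi z).mp hz; linarith)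
  have h := quadric_of_add_eq (u := v + -w) h2 h3 h1 p'
  rw [quadric_add, quadric_neg, hp', (hc p').mp hp', neg_zero, add_zero] at h
  have h0 := (mul_eq_zero.mp h.symm).resolve_right hne.ne'
  simp only [Pi.add_apply, Pi.neg_apply] at h0 h1 h2 h3
  rw [h0] at h1 h2 h3
  ext i; fin_cases i <;> simp <;> linarith

/-- Boundedness separates lines from round circles and is visibly invariant under similarities. -/
theorem not_isLine_iff_isBounded (C : Circle) : ¬ C.IsLine ↔ Bornology.IsBounded C.carrier := by
  constructor
  · intro h
    rcases C.spec with ⟨c, r, hr, h1, -⟩ | ⟨n, k, hn, h1, -⟩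
    · rw [h1]; exact Metric.isBounded_sphere
    · exact absurd ⟨n, k, hn, h1⟩ h
  · rintro hb ⟨n, k, hn, h1⟩
    rw [h1] at hb
    have hsq : 0 < n 0 ^ 2 + n 1 ^ 2 := by
      by_contra h
      exact hn (plane_ext (by simpa using (by nlinarith [sq_nonneg (n 0), sq_nonneg (n 1)] : n 0 = 0))
        (by simpa using (by nlinarith [sq_nonneg (n 0), sq_nonneg (n 1)] : n 1 = 0)))
    obtain ⟨R, hR⟩ := hb.exists_norm_le
    -- These are the points of the line: the foot of the perpendicular from the origin plus t times
    -- the rotated normal.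
    have key : ∀ t : ℝ, (k * n 0 / (n 0 ^ 2 + n 1 ^ 2) - t * n 1) ^ 2
        + (k * n 1 / (n 0 ^ 2 + n 1 ^ 2) + t * n 0) ^ 2 ≤ R ^ 2 := by
      intro t
      have h := hR !₂[k * n 0 / (n 0 ^ 2 + n 1 ^ 2) - t * n 1,
        k * n 1 / (n 0 ^ 2 + n 1 ^ 2) + t * n 0] (by
          simp only [Set.mem_ofPred_eq, inner_plane, Matrix.cons_val_zero,
            Matrix.cons_val_one]
          field_simp; ring)
      have h2 := pow_le_pow_left₀ (norm_nonneg _) h 2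
      rw [← dist_zero_right, dist_sq_eq] at h2
      simpa using h2
    have h := key ((R ^ 2 + 1) / (n 0 ^ 2 + n 1 ^ 2) + 1)
    have e : ∀ t : ℝ, (k * n 0 / (n 0 ^ 2 + n 1 ^ 2) - t * n 1) ^ 2
        + (k * n 1 / (n 0 ^ 2 + n 1 ^ 2) + t * n 0) ^ 2
        = k ^ 2 / (n 0 ^ 2 + n 1 ^ 2) + t ^ 2 * (n 0 ^ 2 + n 1 ^ 2) := by
      intro t; field_simp; ring
    rw [e] at h
    have hk : 0 ≤ k ^ 2 / (n 0 ^ 2 + n 1 ^ 2) := by positivity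
    have e2 : (R ^ 2 + 1) / (n 0 ^ 2 + n 1 ^ 2) * (n 0 ^ 2 + n 1 ^ 2) = R ^ 2 + 1 :=
      div_mul_cancel₀ _ hsq.ne'
    have hx : 0 ≤ (R ^ 2 + 1) / (n 0 ^ 2 + n 1 ^ 2) := by positivity
    nlinarith [mul_nonneg (sq_nonneg ((R ^ 2 + 1) / (n 0 ^ 2 + n 1 ^ 2))) hsq.le]

theorem Represents.isLine_iff {C : Circle} {v : Fin 4 → ℝ} (hv : Represents C v) :
    C.IsLine ↔ v 0 = 0 := by
  rcases C.spec with ⟨c, r, hr, h1, h2⟩ | ⟨n, k, hn, h1, h2⟩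
  · have hb : ¬ C.IsLine := by
      rw [not_isLine_iff_isBounded, h1]; exact Metric.isBounded_sphere
    refine iff_of_false hb ?_
    rcases h2 with h2 | h2
    · rw [hv.vec_eq (represents_ball hr h1 h2)]; simp [discVec, hr.ne']
    · rw [hv.vec_eq (represents_exterior hr h1 h2)]; simp [discVec, hr.ne']
  · refine iff_of_true ⟨n, k, hn, h1⟩ ?_
    obtain ⟨w, hw, hw0⟩ := represents_line hn h1 h2
    rw [hv.vec_eq hw, hw0]

/-! ### Tangency in terms of the Lorentzian form -/

/-- The sum of the vectors `v` and `w` lies in the future cone, or at its boundary. -/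
def FutureSum (v w : Fin 4 → ℝ) : Prop := 0 < v 0 + w 0 ∨ (v 0 + w 0 = 0 ∧ 0 < v 1 + w 1)

theorem form_eq_of_parallel {v w : Fin 4 → ℝ} (hv : form v v = 1) (hw : form w w = 1)
    (hv0 : v 0 = 0) (hw0 : w 0 = 0) (hd : ∀ z, quadric v z < 0 → ¬ quadric w z < 0)
    (hc : ∀ z, quadric v z = 0 → ¬ quadric w z = 0) : form v w = -1 ∧ FutureSum v w := by
  have hv' : v 2 ^ 2 + v 3 ^ 2 = 1 := by unfold form at hv; rw [hv0] at hv; linarith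
  have hw' : w 2 ^ 2 + w 3 ^ 2 = 1 := by unfold form at hw; rw [hw0] at hw; linarith
  -- Linearly independent normals would give a common point by Cramer's rule.
  have hD : v 2 * w 3 - v 3 * w 2 = 0 := by
    by_contra hD
    have he := mul_inv_cancel₀ hD
    refine hc !₂[(v 1 / 2 * w 3 - v 3 * (w 1 / 2)) * (v 2 * w 3 - v 3 * w 2)⁻¹,
      (v 2 * (w 1 / 2) - v 1 / 2 * w 2) * (v 2 * w 3 - v 3 * w 2)⁻¹] ?_ ?_
    · simp only [quadric, hv0, Matrix.cons_val_zero, Matrix.cons_val_one]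
      linear_combination -v 1 * he
    · simp only [quadric, hw0, Matrix.cons_val_zero, Matrix.cons_val_one]
      linear_combination -w 1 * he
  have hsq : (v 2 * w 2 + v 3 * w 3 - 1) * (v 2 * w 2 + v 3 * w 3 + 1) = 0 := by
    linear_combination (w 2 ^ 2 + w 3 ^ 2) * hv' + hw' - (v 2 * w 3 - v 3 * w 2) * hD
  have hm : v 2 * w 2 + v 3 * w 3 = -1 := by
    rcases mul_eq_zero.mp hsq with h | h
    · exfalso
      -- Half-planes with equal normals overlap far out in the direction of the normal.
      refine hd !₂[(|v 1| + |w 1| + 1) * v 2, (|v 1| + |w 1| + 1) * v 3] ?_ ?_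
      · have : quadric v !₂[(|v 1| + |w 1| + 1) * v 2, (|v 1| + |w 1| + 1) * v 3]
            = -2 * (|v 1| + |w 1| + 1) + v 1 := by
          simp only [quadric, hv0, Matrix.cons_val_zero, Matrix.cons_val_one]
          linear_combination -2 * (|v 1| + |w 1| + 1) * hv'
        rw [this]; linarith [le_abs_self (v 1), abs_nonneg (w 1), abs_nonneg (v 1)]
      · have : quadric w !₂[(|v 1| + |w 1| + 1) * v 2, (|v 1| + |w 1| + 1) * v 3]
            = -2 * (|v 1| + |w 1| + 1) + w 1 := by
          simp only [quadric, hw0, Matrix.cons_val_zero, Matrix.cons_val_one]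
          linear_combination -2 * (|v 1| + |w 1| + 1) * h
        rw [this]; linarith [le_abs_self (w 1), abs_nonneg (w 1), abs_nonneg (v 1)]
    · linarith
  -- At the point midway between the parallel lines both functions have the same value, so its sign
  -- decides between overlapping interiors, equal lines and tangency.
  have e1 : quadric v !₂[(v 1 - w 1) / 4 * v 2, (v 1 - w 1) / 4 * v 3] = (v 1 + w 1) / 2 := by
    simp only [quadric, hv0, Matrix.cons_val_zero, Matrix.cons_val_one]
    linear_combination -2 * ((v 1 - w 1) / 4) * hv'
  have e2 : quadric w !₂[(v 1 - w 1) / 4 * v 2, (v 1 - w 1) / 4 * v 3] = (v 1 + w 1) / 2 := by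
    simp only [quadric, hw0, Matrix.cons_val_zero, Matrix.cons_val_one]
    linear_combination -2 * ((v 1 - w 1) / 4) * hm
  refine ⟨by unfold form; rw [hm, hv0, hw0]; ring, Or.inr ⟨by rw [hv0, hw0, add_zero], ?_⟩⟩
  rcases lt_trichotomy (v 1 + w 1) 0 with h | h | h
  · exact absurd (by rw [e2]; linarith) (hd _ (by rw [e1]; linarith))
  · exact absurd (by rw [e2, h, zero_div]) (hc _ (by rw [e1, h, zero_div]))
  · exact h

theorem form_eq_of_common_point {v w : Fin 4 → ℝ} (hv : form v v = 1) (hw : form w w = 1)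
    (hd : ∀ z, quadric v z < 0 → ¬ quadric w z < 0) {p : Plane}
    (hp : ∀ z, (quadric v z = 0 ∧ quadric w z = 0) ↔ z = p) :
    form v w = -1 ∧ FutureSum v w := by
  obtain ⟨hvp, hwp⟩ := (hp p).mpr rfl
  obtain ⟨h2, h3, h1⟩ := add_eq_of_disjoint hv hw hvp hwp hd
  have hform : form v w = -1 := by
    unfold form at hv hw ⊢
    linear_combination (v 2 + w 2 + (v 0 + w 0) * p 0) / 2 * h2
      + (v 3 + w 3 + (v 0 + w 0) * p 1) / 2 * h3 - (v 0 + w 0) / 2 * h1 - hv / 2 - hw / 2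
  refine ⟨hform, ?_⟩
  rcases lt_trichotomy (v 0 + w 0) 0 with h | h | h
  · exfalso
    obtain ⟨a, ha⟩ : ∃ a, a = v 2 - v 0 * p 0 := ⟨_, rfl⟩
    obtain ⟨b, hb⟩ : ∃ b, b = v 3 - v 0 * p 1 := ⟨_, rfl⟩
    -- Inversion at p turns the two curves into parallel lines with normal (a, b), and s is the
    -- height midway between them. The point used below is the inverse of p + s(a, b) + (−b, a); the
    -- tangential term keeps it away from p.
    obtain ⟨s, hs⟩ : ∃ s, s = (v 0 - w 0) / 4 := ⟨_, rfl⟩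
    have hab : a ^ 2 + b ^ 2 = 1 := by
      unfold form at hv; unfold quadric at hvp; subst ha hb; linear_combination hv + v 0 * hvp
    have hs1 : (0 : ℝ) < s ^ 2 + 1 := by positivity
    have hq : quadric v !₂[p 0 + (s * a - b) / (s ^ 2 + 1), p 1 + (s * b + a) / (s ^ 2 + 1)]
        = (v 0 + w 0) / 2 / (s ^ 2 + 1) := by
      unfold quadric at hvp ⊢
      simp only [Matrix.cons_val_zero, Matrix.cons_val_one]
      have h2' : v 2 = a + v 0 * p 0 := by linarith
      have h3' : v 3 = b + v 0 * p 1 := by linarith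
      have hw0 : v 0 + w 0 = 2 * v 0 - 4 * s := by rw [hs]; ring
      rw [hw0]
      rw [h2', h3'] at hvp ⊢
      field_simp
      linear_combination 2 * (s ^ 2 + 1) ^ 2 * hvp +
        2 * (v 0 * (s ^ 2 + 1) - 2 * s * (s ^ 2 + 1)) * hab
    have hq' : quadric w !₂[p 0 + (s * a - b) / (s ^ 2 + 1), p 1 + (s * b + a) / (s ^ 2 + 1)]
        = (v 0 + w 0) / 2 / (s ^ 2 + 1) := by
      have e := quadric_of_add_eq (u := v + w) h2 h3 h1
        !₂[p 0 + (s * a - b) / (s ^ 2 + 1), p 1 + (s * b + a) / (s ^ 2 + 1)]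
      rw [quadric_add, hq] at e
      simp only [Matrix.cons_val_zero, Matrix.cons_val_one, Pi.add_apply] at e
      have : ((s * a - b) / (s ^ 2 + 1)) ^ 2 + ((s * b + a) / (s ^ 2 + 1)) ^ 2
          = 1 / (s ^ 2 + 1) := by
        field_simp; linear_combination (s ^ 2 + 1) * hab
      rw [add_sub_cancel_left, add_sub_cancel_left, this] at e
      rw [eq_sub_of_add_eq' e]; ring
    have hneg : (v 0 + w 0) / 2 / (s ^ 2 + 1) < 0 := div_neg_of_neg_of_pos (by linarith) hs1
    exact hd _ (hq.trans_lt hneg) (hq'.trans_lt hneg)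
  -- Here w = −v, so the curves coincide and share more than one point.
  · exfalso
    rw [h, zero_mul] at h1 h2 h3
    obtain ⟨x, y, hx, hy, hne⟩ := exists_two_points hv
    have hall : ∀ z, quadric v z = 0 → z = p := fun z hz => (hp z).mp ⟨hz, by
      have e := quadric_of_add_eq (u := v + w) (p := p) (by simp [h2, h]) (by simp [h3, h])
        (by simp [h1, h]) z
      rw [quadric_add, hz] at e
      simpa [h] using e⟩
    rw [hall x hx, hall y hy] at hne
    simp at hne
  · exact Or.inl h

theorem Represents.disjoint_interior_iff {C D : Circle} {v w : Fin 4 → ℝ} (hC : Represents C v)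
    (hD : Represents D w) :
    Disjoint C.interior D.interior ↔ ∀ z, quadric v z < 0 → ¬ quadric w z < 0 := by
  rw [Set.disjoint_left, hC.2.2, hD.2.2]; rfl

/-- For the converse, form −1 makes v + w null. If its curvature is positive, the sum of the two
quadratic functions is that curvature times the squared distance to one point, which is the tangency
point. If the curvature is zero, the sum is a positive constant and both circles are lines. -/
theorem Represents.tangent_iff {C D : Circle} {v w : Fin 4 → ℝ} (hC : Represents C v)
    (hD : Represents D w) : Tangent C D ↔ form v w = -1 ∧ FutureSum v w := by
  unfold Tangent
  rw [hC.disjoint_interior_iff hD, hC.isLine_iff, hD.isLine_iff, Set.disjoint_left, hC.2.1, hD.2.1]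
  constructor
  · rintro ⟨hd, ⟨hv0, hw0, hc⟩ | ⟨-, p, hp⟩⟩
    · exact form_eq_of_parallel hC.1 hD.1 hv0 hw0 hd hc
    · exact form_eq_of_common_point hC.1 hD.1 hd fun z => Set.ext_iff.mp hp z
  · rintro ⟨hf, h⟩
    have hv := hC.1
    have hw := hD.1
    unfold form at hv hw hf
    have hnull : (v 2 + w 2) ^ 2 + (v 3 + w 3) ^ 2 = (v 0 + w 0) * (v 1 + w 1) := by
      linear_combination hv + hw + 2 * hf
    rcases h with h | ⟨h, h'⟩
    · have e := fun z => quadric_of_add_eq (u := v + w)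
        (p := !₂[(v 2 + w 2) / (v 0 + w 0), (v 3 + w 3) / (v 0 + w 0)])
        (by simp; field_simp) (by simp; field_simp)
        (by simp; field_simp; linarith) z
      simp only [quadric_add, Pi.add_apply, Matrix.cons_val_zero, Matrix.cons_val_one] at e
      refine ⟨fun z h1 h2 => ?_, Or.inr ⟨fun h0 => by rw [h0.1, h0.2] at h; simp at h,
        !₂[(v 2 + w 2) / (v 0 + w 0), (v 3 + w 3) / (v 0 + w 0)], ?_⟩⟩
      · have : 0 ≤ quadric v z + quadric w z := by rw [e]; positivity
        linarith
      · have hvp : quadric v !₂[(v 2 + w 2) / (v 0 + w 0), (v 3 + w 3) / (v 0 + w 0)] = 0 := by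
          simp [quadric]; field_simp
          linear_combination v 0 * hnull + (-2) * (v 0 + w 0) * hv - 2 * (v 0 + w 0) * hf
        have hwp : quadric w !₂[(v 2 + w 2) / (v 0 + w 0), (v 3 + w 3) / (v 0 + w 0)] = 0 := by
          simp [quadric]; field_simp
          linear_combination w 0 * hnull + (-2) * (v 0 + w 0) * hw - 2 * (v 0 + w 0) * hf
        ext z
        constructor
        · rintro ⟨h1, h2⟩
          have h1 : quadric v z = 0 := h1
          have h2 : quadric w z = 0 := h2
          have ez := e z
          rw [h1, h2, add_zero] at ez
          have ez := (mul_eq_zero.mp ez.symm).resolve_left h.ne'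
          have s0 := sq_nonneg (z 0 - (v 2 + w 2) / (v 0 + w 0))
          have s1 := sq_nonneg (z 1 - (v 3 + w 3) / (v 0 + w 0))
          have z0 : z 0 - (v 2 + w 2) / (v 0 + w 0) = 0 := pow_eq_zero_iff two_ne_zero |>.mp
            (by linarith)
          have z1 : z 1 - (v 3 + w 3) / (v 0 + w 0) = 0 := pow_eq_zero_iff two_ne_zero |>.mp
            (by linarith)
          exact plane_ext (sub_eq_zero.mp z0) (sub_eq_zero.mp z1)
        · rintro rfl
          exact ⟨hvp, hwp⟩
    · rw [h, zero_mul] at hnull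
      have h2 : v 2 + w 2 = 0 := by nlinarith [sq_nonneg (v 2 + w 2), sq_nonneg (v 3 + w 3)]
      have h3 : v 3 + w 3 = 0 := by nlinarith [sq_nonneg (v 2 + w 2), sq_nonneg (v 3 + w 3)]
      have hw2 : w 2 = -v 2 := by linarith
      have hw3 : w 3 = -v 3 := by linarith
      have hw0 : w 0 = -v 0 := by linarith
      have hv0 : v 0 * (v 1 + w 1) = 0 := by
        rw [hw2, hw3, hw0] at hf; linear_combination -2 * hv - 2 * hf
      have hv0 := (mul_eq_zero.mp hv0).resolve_right h'.ne'
      rw [hv0, neg_zero] at hw0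
      have e : ∀ z, quadric v z + quadric w z = v 1 + w 1 := by
        intro z; unfold quadric; rw [hv0, hw0, hw2, hw3]; ring
      refine ⟨fun z h1 h2 => ?_, Or.inl ⟨hv0, hw0, fun z h1 h2 => ?_⟩⟩
      · linarith [e z]
      · have h1 : quadric v z = 0 := h1
        have h2 : quadric w z = 0 := h2
        linarith [e z]

/-! ### Similarities acting on packings -/

@[simp] theorem map_carrier (Φ : Plane ≃ᵈ Plane) (C : Circle) :
    (C.map Φ).carrier = Φ '' C.carrier := rfl

@[simp] theorem map_interior (Φ : Plane ≃ᵈ Plane) (C : Circle) :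
    (C.map Φ).interior = Φ '' C.interior := rfl

theorem map_map (Φ Ψ : Plane ≃ᵈ Plane) (C : Circle) : (C.map Φ).map Ψ = C.map (Φ.trans Ψ) :=
  Circle.ext (Set.image_image _ _ _) (Set.image_image _ _ _)

theorem map_refl (C : Circle) : C.map (DilationEquiv.refl Plane) = C :=
  Circle.ext (Set.image_id _) (Set.image_id _)

theorem map_symm_map (Φ : Plane ≃ᵈ Plane) (C : Circle) : (C.map Φ).map Φ.symm = C := by
  rw [map_map, DilationEquiv.self_trans_symm, map_refl]

theorem map_map_symm (Φ : Plane ≃ᵈ Plane) (C : Circle) : (C.map Φ.symm).map Φ = C := by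
  rw [map_map, DilationEquiv.symm_trans_self, map_refl]

theorem isBounded_image_iff (Φ : Plane ≃ᵈ Plane) (s : Set Plane) :
    Bornology.IsBounded (Φ '' s) ↔ Bornology.IsBounded s := by
  refine ⟨fun h => ?_, fun h => (Dilation.lipschitz Φ).isBounded_image h⟩
  have := (Dilation.lipschitz Φ.symm).isBounded_image h
  rwa [Set.image_image, funext Φ.symm_apply_apply, Set.image_id'] at this

theorem isLine_map_iff (Φ : Plane ≃ᵈ Plane) (C : Circle) : (C.map Φ).IsLine ↔ C.IsLine := by
  rw [← not_iff_not, not_isLine_iff_isBounded, not_isLine_iff_isBounded, map_carrier,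
    isBounded_image_iff]

theorem tangent_map_iff (Φ : Plane ≃ᵈ Plane) (C D : Circle) :
    Tangent (C.map Φ) (D.map Φ) ↔ Tangent C D := by
  have h : (∃ p, Φ '' (C.carrier ∩ D.carrier) = {p}) ↔ ∃ p, C.carrier ∩ D.carrier = {p} := by
    constructor
    · rintro ⟨p, hp⟩
      obtain ⟨q, rfl⟩ := Φ.surjective p
      exact ⟨q, Φ.injective.image_injective (hp.trans (Set.image_singleton).symm)⟩
    · rintro ⟨p, hp⟩
      exact ⟨Φ p, by rw [hp, Set.image_singleton]⟩
  unfold Tangent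
  rw [isLine_map_iff, isLine_map_iff, map_carrier, map_carrier, map_interior, map_interior,
    Set.disjoint_image_iff Φ.injective, Set.disjoint_image_iff Φ.injective,
    ← Set.image_inter Φ.injective, h]

/-- A set of circles that contains every circle tangent to three mutually tangent members. -/
def ApollonianClosed (P : Set Circle) : Prop :=
  ∀ A ∈ P, ∀ B ∈ P, ∀ C ∈ P, ∀ D, MutuallyTangent A B C → Tangent D A → Tangent D B →
    Tangent D C → D ∈ P

theorem subset_packing (T : Set Circle) : T ⊆ packing T := Set.subset_iUnion (stage T) 0

theorem stage_mono (T : Set Circle) : Monotone (stage T) :=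
  monotone_nat_of_le_succ fun _ => Set.subset_union_left

theorem apollonianClosed_packing (T : Set Circle) : ApollonianClosed (packing T) := by
  intro A hA B hB C hC D h hDA hDB hDC
  obtain ⟨i, hA⟩ := Set.mem_iUnion.mp hA
  obtain ⟨j, hB⟩ := Set.mem_iUnion.mp hB
  obtain ⟨k, hC⟩ := Set.mem_iUnion.mp hC
  refine Set.mem_iUnion.mpr ⟨max i (max j k) + 1, Or.inr ⟨A, ?_, B, ?_, C, ?_, h, hDA, hDB, hDC⟩⟩
  · exact stage_mono T (le_max_left _ _) hA
  · exact stage_mono T ((le_max_left j k).trans (le_max_right _ _)) hB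
  · exact stage_mono T ((le_max_right j k).trans (le_max_right _ _)) hC

theorem ApollonianClosed.packing_subset {T P : Set Circle} (hP : ApollonianClosed P) (h : T ⊆ P) :
    packing T ⊆ P := by
  refine Set.iUnion_subset fun n => ?_
  induction n with
  | zero => exact h
  | succ n ih =>
    rintro D (hD | ⟨A, hA, B, hB, C, hC, hm, h1, h2, h3⟩)
    · exact ih hD
    · exact hP A (ih hA) B (ih hB) C (ih hC) D hm h1 h2 h3

theorem mem_mapPacking_iff (Φ : Plane ≃ᵈ Plane) (P : Set Circle) (C : Circle) :
    C ∈ mapPacking Φ P ↔ C.map Φ.symm ∈ P := by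
  constructor
  · rintro ⟨D, hD, rfl⟩
    rwa [map_symm_map]
  · exact fun h => ⟨_, h, map_map_symm Φ C⟩

theorem ApollonianClosed.mapPacking {P : Set Circle} (hP : ApollonianClosed P)
    (Φ : Plane ≃ᵈ Plane) : ApollonianClosed (mapPacking Φ P) := by
  intro A hA B hB C hC D h h1 h2 h3
  rw [mem_mapPacking_iff] at hA hB hC ⊢
  unfold MutuallyTangent at h
  refine hP _ hA _ hB _ hC _ ?_ ?_ ?_ ?_
  · unfold MutuallyTangent
    simpa only [tangent_map_iff] using h
  all_goals simpa only [tangent_map_iff]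

/-- A packing is the smallest closed set containing its generators, and closedness is preserved by Φ
and its inverse. -/
theorem mapPacking_packing (Φ : Plane ≃ᵈ Plane) (T : Set Circle) :
    mapPacking Φ (packing T) = packing (mapPacking Φ T) := by
  apply subset_antisymm
  · have h : packing T ⊆ mapPacking Φ.symm (packing (mapPacking Φ T)) := by
      refine ((apollonianClosed_packing _).mapPacking Φ.symm).packing_subset fun C hC => ?_
      rw [mem_mapPacking_iff, DilationEquiv.symm_symm]
      exact subset_packing _ ⟨C, hC, rfl⟩
    rintro _ ⟨C, hC, rfl⟩
    simpa [mem_mapPacking_iff] using h hC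
  · refine ((apollonianClosed_packing _).mapPacking Φ).packing_subset ?_
    exact Set.image_mono (subset_packing T)

theorem mapPacking_symm_eq {Φ : Plane ≃ᵈ Plane} {P Q : Set Circle} (h : mapPacking Φ P = Q) :
    mapPacking Φ.symm Q = P := by
  subst h
  ext C
  simp [mem_mapPacking_iff, map_symm_map]

/-! ### Quadruples of mutually tangent circles -/

/-- The linear functional `form v`. -/
def formL (v : Fin 4 → ℝ) : (Fin 4 → ℝ) →ₗ[ℝ] ℝ where
  toFun := form v
  map_add' x y := by rw [form_comm, form_add_left, form_comm x, form_comm y]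
  map_smul' a x := by rw [form_comm, form_smul_left, form_comm x]; rfl

@[simp] theorem formL_apply (v w : Fin 4 → ℝ) : formL v w = form v w := rfl

/-- Four unit vectors with all products `-1`. -/
def IsQuad (q : Fin 4 → Fin 4 → ℝ) : Prop := ∀ i j, form (q i) (q j) = if i = j then 1 else -1

/-- The other solution of the problem to complete the members `≠ k` to a quadruple. -/
def opposite (q : Fin 4 → Fin 4 → ℝ) (k : Fin 4) : Fin 4 → ℝ := (2 : ℝ) • ∑ i, q i - (3 : ℝ) • q k

/-- Replace one member of a quadruple by the opposite one. -/
def swapAt (k : Fin 4) (q : Fin 4 → Fin 4 → ℝ) : Fin 4 → Fin 4 → ℝ :=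
  Function.update q k (opposite q k)

theorem map_opposite (f : (Fin 4 → ℝ) →ₗ[ℝ] ℝ) (q : Fin 4 → Fin 4 → ℝ) (k : Fin 4) :
    f (opposite q k) = 2 * ∑ i, f (q i) - 3 * f (q k) := by
  simp [opposite, map_sum]

theorem swapAt_same (k : Fin 4) (q : Fin 4 → Fin 4 → ℝ) : swapAt k q k = opposite q k :=
  Function.update_self ..

theorem swapAt_of_ne {k i : Fin 4} (h : i ≠ k) (q : Fin 4 → Fin 4 → ℝ) : swapAt k q i = q i :=
  Function.update_of_ne h ..

theorem sum_swapAt {M : Type*} [AddCommGroup M] (f : (Fin 4 → ℝ) → M) (k : Fin 4)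
    (q : Fin 4 → Fin 4 → ℝ) :
    ∑ i, f (swapAt k q i) = ∑ i, f (q i) - f (q k) + f (opposite q k) := by
  rw [← Finset.add_sum_erase _ _ (Finset.mem_univ k),
    ← Finset.add_sum_erase Finset.univ (fun i => f (q i)) (Finset.mem_univ k), swapAt_same,
    Finset.sum_congr rfl fun i hi => by rw [swapAt_of_ne (Finset.ne_of_mem_erase hi)]]
  abel

theorem swapAt_swapAt (k : Fin 4) (q : Fin 4 → Fin 4 → ℝ) : swapAt k (swapAt k q) = q := by
  funext i
  by_cases h : i = k
  · subst h
    rw [swapAt_same]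
    conv_lhs => unfold opposite
    rw [sum_swapAt (fun v => v), swapAt_same]
    simp only [opposite]
    module
  · rw [swapAt_of_ne h, swapAt_of_ne h]

theorem IsQuad.form_sum {q : Fin 4 → Fin 4 → ℝ} (hq : IsQuad q) (i : Fin 4) :
    ∑ j, form (q i) (q j) = -2 := by
  simp only [hq i]
  fin_cases i <;> simp [Fin.sum_univ_four] <;> norm_num

/-- The product −7 of a vector with its opposite, against the tangency value −1, is the gap on which
the growth estimates rest. -/
theorem IsQuad.form_opposite {q : Fin 4 → Fin 4 → ℝ} (hq : IsQuad q) (i k : Fin 4) :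
    form (q i) (opposite q k) = if i = k then -7 else -1 := by
  rw [← formL_apply, map_opposite]
  simp only [formL_apply]
  rw [hq.form_sum, hq i k]
  split_ifs <;> norm_num

theorem IsQuad.swapAt {q : Fin 4 → Fin 4 → ℝ} (hq : IsQuad q) (k : Fin 4) :
    IsQuad (swapAt k q) := by
  intro i j
  by_cases hi : i = k <;> by_cases hj : j = k
  · subst hi hj
    rw [swapAt_same, if_pos rfl, ← formL_apply, map_opposite]
    simp only [formL_apply, form_comm _ (q _), hq.form_opposite]
    fin_cases j <;> simp [Fin.sum_univ_four] <;> norm_num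
  · subst hi
    rw [swapAt_same, swapAt_of_ne hj, form_comm, hq.form_opposite, if_neg hj, if_neg (Ne.symm hj)]
  · subst hj
    rw [swapAt_same, swapAt_of_ne hi, hq.form_opposite, if_neg hi, if_neg hi]
  · rw [swapAt_of_ne hi, swapAt_of_ne hj, hq]

/-! ### Orbits of quadruples under swaps -/

/-- `Reach S q r`: the quadruple `r` arises from `q` by swaps at indices in `S`. -/
inductive Reach (S : Set (Fin 4)) (q : Fin 4 → Fin 4 → ℝ) : (Fin 4 → Fin 4 → ℝ) → Prop
  | refl : Reach S q q
  | step {r : Fin 4 → Fin 4 → ℝ} {k : Fin 4} : k ∈ S → Reach S q r → Reach S q (swapAt k r)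

theorem Reach.trans {S : Set (Fin 4)} {p q r : Fin 4 → Fin 4 → ℝ} (h : Reach S p q)
    (h' : Reach S q r) : Reach S p r := by
  induction h' with
  | refl => exact h
  | step hk _ ih => exact ih.step hk

theorem Reach.symm {S : Set (Fin 4)} {q r : Fin 4 → Fin 4 → ℝ} (h : Reach S q r) :
    Reach S r q := by
  induction h with
  | refl => exact .refl
  | @step r k hk _ ih =>
    refine Reach.trans ?_ ih
    have := Reach.step hk (Reach.refl (S := S) (q := swapAt k r))
    rwa [swapAt_swapAt] at this

theorem Reach.mono {S T : Set (Fin 4)} (hST : S ⊆ T) {q r : Fin 4 → Fin 4 → ℝ} (h : Reach S q r) :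
    Reach T q r := by
  induction h with
  | refl => exact .refl
  | step hk _ ih => exact ih.step (hST hk)

theorem Reach.isQuad {S : Set (Fin 4)} {q r : Fin 4 → Fin 4 → ℝ} (h : Reach S q r)
    (hq : IsQuad q) : IsQuad r := by
  induction h with
  | refl => exact hq
  | step _ _ ih => exact ih.swapAt _

theorem Reach.apply_eq {S : Set (Fin 4)} {q r : Fin 4 → Fin 4 → ℝ} (h : Reach S q r) {i : Fin 4}
    (hi : i ∉ S) : r i = q i := by
  induction h with
  | refl => rfl
  | step hk _ ih => rw [swapAt_of_ne (fun h => hi (by rw [h]; exact hk)), ih]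

/-- The quadruples that arise by sequences of swaps without immediate repetition, together with the
index of the last swap. -/
inductive Reduced (q : Fin 4 → Fin 4 → ℝ) : Option (Fin 4) → (Fin 4 → Fin 4 → ℝ) → Prop
  | nil : Reduced q none q
  | cons {o : Option (Fin 4)} {r : Fin 4 → Fin 4 → ℝ} {k : Fin 4} : o ≠ some k → Reduced q o r →
      Reduced q (some k) (swapAt k r)

theorem Reach.exists_reduced {S : Set (Fin 4)} {q r : Fin 4 → Fin 4 → ℝ} (h : Reach S q r) :
    ∃ o, Reduced q o r := by
  induction h with
  | refl => exact ⟨none, .nil⟩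
  | @step r k _ _ ih =>
    obtain ⟨o, ho⟩ := ih
    by_cases hk : o = some k
    · subst hk
      cases ho with
      | @cons o r _ _ h => exact ⟨o, by rwa [swapAt_swapAt]⟩
    · exact ⟨some k, ho.cons hk⟩

/-- The vectors of the quadruples reached from `q`. -/
def orbit (S : Set (Fin 4)) (q : Fin 4 → Fin 4 → ℝ) : Set (Fin 4 → ℝ) :=
  {v | ∃ r, Reach S q r ∧ ∃ i, r i = v}

theorem Reach.orbit_eq {S : Set (Fin 4)} {q r : Fin 4 → Fin 4 → ℝ} (h : Reach S q r) :
    orbit S r = orbit S q :=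
  Set.ext fun _ => ⟨fun ⟨r', hr', hi⟩ => ⟨r', h.trans hr', hi⟩,
    fun ⟨r', hr', hi⟩ => ⟨r', h.symm.trans hr', hi⟩⟩

/-- Growth along reduced sequences: outside of the part of the orbit reached without swapping the
indices outside `S`, the functional `f` is at least `c`. -/
theorem mem_orbit_or_le {S : Set (Fin 4)} {q : Fin 4 → Fin 4 → ℝ} (f : (Fin 4 → ℝ) →ₗ[ℝ] ℝ) {c : ℝ}
    (hc : 0 ≤ c)
    (H : ∀ r, Reach S q r → ∀ k ∉ S, ∑ i, f (r i) - f (r k) ≤ f (opposite r k) ∧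
      c ≤ f (opposite r k) ∧ ∀ i, i ≠ k → 0 ≤ f (r i))
    {v : Fin 4 → ℝ} (hv : v ∈ orbit Set.univ q) : v ∈ orbit S q ∨ c ≤ f v := by
  -- Invariant once an index outside S has been swapped: all values are nonnegative and the last
  -- swapped member k carries at least half of the sum. The next swap is at some m ≠ k, so f(r m) ≤
  -- f(r k), and the new value 2Σ − 3f(r m) is at least f(r k) and again at least half of the new
  -- sum.
  have key : ∀ o r, Reduced q o r → Reach S q r ∨ ∃ k, o = some k ∧
      ∑ i, f (r i) ≤ 2 * f (r k) ∧ (∀ i, 0 ≤ f (r i)) ∧ c ≤ f (r k) ∧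
      ∀ i, r i ∈ orbit S q ∨ c ≤ f (r i) := by
    intro o r h
    induction h with
    | nil => exact Or.inl .refl
    | @cons o r m hm _ ih =>
      rcases ih with ih | ⟨k, rfl, hs, h0, hck, hg⟩
      · by_cases hmS : m ∈ S
        · exact Or.inl (ih.step hmS)
        · obtain ⟨h1, h2, h3⟩ := H r ih m hmS
          refine Or.inr ⟨m, rfl, ?_, fun i => ?_, ?_, fun i => ?_⟩
          · rw [sum_swapAt, swapAt_same]; linarith
          · by_cases hi : i = m
            · subst hi; rw [swapAt_same]; linarith
            · rw [swapAt_of_ne hi]; exact h3 i hi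
          · rwa [swapAt_same]
          · by_cases hi : i = m
            · subst hi; rw [swapAt_same]; exact Or.inr h2
            · rw [swapAt_of_ne hi]; exact Or.inl ⟨r, ih, i, rfl⟩
      · have hkm : k ≠ m := fun h => hm (by rw [h])
        have hpair : f (r k) + f (r m) ≤ ∑ i, f (r i) := by
          rw [← Finset.sum_pair (f := fun i => f (r i)) hkm]
          exact Finset.sum_le_sum_of_subset_of_nonneg (Finset.subset_univ _) fun i _ _ => h0 i
        have hop := map_opposite f r m
        have hcm : f (r k) ≤ f (opposite r m) := by rw [hop]; linarith
        refine Or.inr ⟨m, rfl, ?_, fun i => ?_, ?_, fun i => ?_⟩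
        · rw [sum_swapAt, swapAt_same, hop]; linarith
        · by_cases hi : i = m
          · subst hi; rw [swapAt_same]; linarith
          · rw [swapAt_of_ne hi]; exact h0 i
        · rw [swapAt_same]; linarith
        · by_cases hi : i = m
          · subst hi; rw [swapAt_same]; exact Or.inr (by linarith)
          · rw [swapAt_of_ne hi]; exact hg i
  obtain ⟨r, hr, i, rfl⟩ := hv
  obtain ⟨o, ho⟩ := hr.exists_reduced
  rcases key o r ho with h | ⟨k, -, -, -, -, h⟩
  · exact Or.inl ⟨r, h, i, rfl⟩
  · exact h i

/-- The functional −form(q i, ·) is −1 at q i and 1 at the other members of a quadruple containing q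
i; swapping q i out creates the value 7, and values outside the smaller orbit never fall below it.
-/
theorem IsQuad.mem_orbit_compl_or_form_le {q : Fin 4 → Fin 4 → ℝ} (hq : IsQuad q) (i : Fin 4)
    {v : Fin 4 → ℝ} (hv : v ∈ orbit Set.univ q) : v ∈ orbit {i}ᶜ q ∨ form (q i) v ≤ -7 := by
  refine (mem_orbit_or_le (S := {i}ᶜ) (-formL (q i)) (c := 7) (by norm_num) ?_ hv).imp_right
    fun h => by simp only [LinearMap.neg_apply, formL_apply] at h; linarith
  intro r hr k hk
  obtain rfl : k = i := by simpa using hk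
  have hr' := hr.isQuad hq
  rw [← hr.apply_eq hk]
  simp only [LinearMap.neg_apply, formL_apply, Finset.sum_neg_distrib, hr'.form_sum,
    hr'.form_opposite, if_true, hr' k k]
  refine ⟨by norm_num, by norm_num, fun i hi => ?_⟩
  rw [hr' k i, if_neg hi.symm]; norm_num

/-- The sum of the two functionals is 0 at q i and q j and 2 at the other two members, and either
swap creates 7 + 1 = 8. -/
theorem IsQuad.mem_orbit_compl_or_form_add_le {q : Fin 4 → Fin 4 → ℝ} (hq : IsQuad q) {i j : Fin 4}
    (hij : i ≠ j) {v : Fin 4 → ℝ} (hv : v ∈ orbit Set.univ q) :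
    v ∈ orbit {i, j}ᶜ q ∨ form (q i) v + form (q j) v ≤ -8 := by
  refine (mem_orbit_or_le (S := {i, j}ᶜ) (-(formL (q i) + formL (q j))) (c := 8) (by norm_num) ?_
    hv).imp_right fun h => by
      simp only [LinearMap.neg_apply, LinearMap.add_apply, formL_apply] at h; linarith
  intro r hr k hk
  have hr' := hr.isQuad hq
  rw [← hr.apply_eq (i := i) (by simp), ← hr.apply_eq (i := j) (by simp)]
  simp only [LinearMap.neg_apply, LinearMap.add_apply, formL_apply, Finset.sum_neg_distrib,
    Finset.sum_add_distrib, hr'.form_sum, hr'.form_opposite]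
  simp only [hr' i, hr' j]
  have hk' : k = i ∨ k = j := Classical.or_iff_not_imp_left.mpr (by simpa using hk)
  have h0 : ∀ m, (0 : ℝ) ≤ -((if i = m then 1 else -1) + if j = m then 1 else -1) := by
    intro m
    by_cases h1 : i = m
    · subst h1; simp [hij.symm]
    · simp only [h1, if_false]; split_ifs <;> norm_num
  refine ⟨?_, ?_, fun m _ => h0 m⟩
  · rcases hk' with rfl | rfl <;> simp [hij, hij.symm] <;> norm_num
  · rcases hk' with rfl | rfl <;> simp [hij, hij.symm] <;> norm_num

/-- Three mutually tangent members of the orbit belong to one quadruple of the orbit. -/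
theorem IsQuad.exists_reach_of_tangent {q : Fin 4 → Fin 4 → ℝ} (hq : IsQuad q)
    {a b c : Fin 4 → ℝ} (ha : a ∈ orbit Set.univ q) (hb : b ∈ orbit Set.univ q)
    (hc : c ∈ orbit Set.univ q) (hab : form a b = -1) (hac : form a c = -1)
    (hbc : form b c = -1) :
    ∃ r, Reach Set.univ q r ∧ ∃ i j k, i ≠ j ∧ i ≠ k ∧ j ≠ k ∧ r i = a ∧ r j = b ∧ r k = c := by
  have ne_of_form {r : Fin 4 → Fin 4 → ℝ} (hr : IsQuad r) {i j : Fin 4}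
      (h : form (r i) (r j) = -1) : i ≠ j := by
    rintro rfl
    rw [hr i i, if_pos rfl] at h
    norm_num at h
  obtain ⟨r, hr, i, rfl⟩ := ha
  have hrq := hr.isQuad hq
  rw [← hr.orbit_eq] at hb
  -- Tangency gives −1 > −7, so b is reached with a kept in place; below, −2 > −8 lets c be reached
  -- with both a and b kept.
  obtain ⟨r', hr', j, rfl⟩ := (hrq.mem_orbit_compl_or_form_le i hb).resolve_right (by linarith)
  rw [← hr'.apply_eq (i := i) (by simp)] at hab hac ⊢
  have hqr' := hr.trans (hr'.mono (Set.subset_univ _))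
  have hrq' := hqr'.isQuad hq
  have hij := ne_of_form hrq' hab
  rw [← hqr'.orbit_eq] at hc
  obtain ⟨s, hs, k, rfl⟩ := (hrq'.mem_orbit_compl_or_form_add_le hij hc).resolve_right (by linarith)
  rw [← hs.apply_eq (i := i) (by simp)] at hac ⊢
  rw [← hs.apply_eq (i := j) (by simp)] at hbc ⊢
  have hqs := hqr'.trans (hs.mono (Set.subset_univ _))
  exact ⟨s, hqs, i, j, k, hij, ne_of_form (hqs.isQuad hq) hac, ne_of_form (hqs.isQuad hq) hbc, rfl,
    rfl, rfl⟩

theorem IsQuad.form_sum_smul {r : Fin 4 → Fin 4 → ℝ} (hr : IsQuad r) (g : Fin 4 → ℝ) (j : Fin 4) :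
    form (r j) (∑ i, g i • r i) = 2 * g j - ∑ i, g i := by
  rw [← formL_apply, map_sum]
  simp only [map_smul, formL_apply, hr j, smul_eq_mul]
  fin_cases j <;> simp [Fin.sum_univ_four] <;> ring

/-- The Gram matrix, twice the identity minus the all-ones matrix, is invertible, so a quadruple is
a basis. -/
theorem IsQuad.exists_eq_sum {r : Fin 4 → Fin 4 → ℝ} (hr : IsQuad r) (v : Fin 4 → ℝ) :
    ∃ g : Fin 4 → ℝ, v = ∑ i, g i • r i := by
  have hli : LinearIndependent ℝ r := by
    rw [Fintype.linearIndependent_iff]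
    intro g hg
    have h : ∀ j, 2 * g j - ∑ i, g i = 0 := fun j => by
      rw [← hr.form_sum_smul, hg, ← formL_apply, map_zero]
    intro i
    have h0 := h 0
    have h1 := h 1
    have h2 := h 2
    have h3 := h 3
    rw [Fin.sum_univ_four] at h0 h1 h2 h3
    fin_cases i <;> simp <;> linarith
  have hb := (basisOfLinearIndependentOfCardEqFinrank hli (by simp)).sum_repr v
  rw [coe_basisOfLinearIndependentOfCardEqFinrank] at hb
  exact ⟨_, hb.symm⟩

theorem exists_fourth : ∀ i j k : Fin 4, i ≠ j → i ≠ k → j ≠ k →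
    ∃ l, l ≠ i ∧ l ≠ j ∧ l ≠ k ∧ (Finset.univ : Finset (Fin 4)) = {i, j, k, l} := by
  decide

/-- A unit vector tangent to three members of a quadruple is the fourth one or its opposite. -/
theorem IsQuad.eq_or_eq_opposite {r : Fin 4 → Fin 4 → ℝ} (hr : IsQuad r) {i j k : Fin 4}
    (hij : i ≠ j) (hik : i ≠ k) (hjk : j ≠ k) {v : Fin 4 → ℝ} (hv : form v v = 1)
    (hi : form (r i) v = -1) (hj : form (r j) v = -1) (hk : form (r k) v = -1) :
    ∃ l, v = r l ∨ v = opposite r l := by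
  obtain ⟨l, hli, hlj, hlk, huniv⟩ := exists_fourth i j k hij hik hjk
  have hsum {M : Type} [AddCommGroup M] (f : Fin 4 → M) : ∑ m, f m = f i + f j + f k + f l := by
    rw [huniv, Finset.sum_insert (by simp [hij, hik, hli.symm]),
      Finset.sum_insert (by simp [hjk, hlj.symm]), Finset.sum_pair hlk.symm]
    abel
  obtain ⟨g, hg⟩ := hr.exists_eq_sum v
  have hform := fun m => hg ▸ hr.form_sum_smul g m
  have hvv : form v v = ∑ m, g m * form (r m) v := by
    have h := congrArg (formL v) hg
    rw [map_sum] at h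
    simpa only [map_smul, formL_apply, smul_eq_mul, form_comm v] using h
  rw [hsum, hi, hj, hk, hform l, hv] at hvv
  have ei := hform i
  have ej := hform j
  have ek := hform k
  rw [hi] at ei
  rw [hj] at ej
  rw [hk] at ek
  rw [hsum g] at ei ej ek hvv
  have h1 : g j = g i := by linarith
  have h2 : g k = g i := by linarith
  have h3 : g l = 1 - g i := by linarith
  rw [h1, h2, h3] at hvv
  -- The three tangencies leave one free coordinate; unit norm makes it a root of x(x − 2). The root
  -- 0 is the fourth member, 2 its opposite.
  have h4 : g i * (g i - 2) = 0 := by linarith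
  rw [hsum, h1, h2, h3] at hg
  refine ⟨l, ?_⟩
  rcases mul_eq_zero.mp h4 with h | h
  · left; rw [hg, h]; module
  · right; rw [hg, show g i = 2 by linarith, opposite, hsum]; module

theorem IsQuad.mem_orbit_of_tangent {q : Fin 4 → Fin 4 → ℝ} (hq : IsQuad q)
    {a b c d : Fin 4 → ℝ} (ha : a ∈ orbit Set.univ q) (hb : b ∈ orbit Set.univ q)
    (hc : c ∈ orbit Set.univ q) (hab : form a b = -1) (hac : form a c = -1)
    (hbc : form b c = -1) (hd : form d d = 1) (had : form a d = -1) (hbd : form b d = -1)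
    (hcd : form c d = -1) : d ∈ orbit Set.univ q := by
  obtain ⟨r, hr, i, j, k, hij, hik, hjk, rfl, rfl, rfl⟩ :=
    hq.exists_reach_of_tangent ha hb hc hab hac hbc
  obtain ⟨l, rfl | rfl⟩ := (hr.isQuad hq).eq_or_eq_opposite hij hik hjk hd had hbd hcd
  · exact ⟨r, hr, l, rfl⟩
  · exact ⟨_, hr.step (Set.mem_univ l), l, swapAt_same l r⟩

/-- The packing generated by three circles of a quadruple consists of circles of its orbit. -/
theorem IsQuad.exists_mem_orbit {q : Fin 4 → Fin 4 → ℝ} (hq : IsQuad q) {T : Set Circle}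
    (hT : ∀ C ∈ T, ∃ i, Represents C (q i)) {C : Circle} (hC : C ∈ packing T) :
    ∃ v ∈ orbit Set.univ q, Represents C v := by
  have h : ApollonianClosed {C | ∃ v ∈ orbit Set.univ q, Represents C v} := by
    rintro A ⟨a, ha, hA⟩ B ⟨b, hb, hB⟩ C ⟨c, hc, hC⟩ D ⟨hAB, hBC, hAC⟩ hDA hDB hDC
    obtain ⟨d, hD⟩ := exists_represents D
    refine ⟨d, ?_, hD⟩
    exact hq.mem_orbit_of_tangent ha hb hc ((hA.tangent_iff hB).mp hAB).1
      ((hA.tangent_iff hC).mp hAC).1 ((hB.tangent_iff hC).mp hBC).1 hD.1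
      (form_comm d a ▸ ((hD.tangent_iff hA).mp hDA).1)
      (form_comm d b ▸ ((hD.tangent_iff hB).mp hDB).1)
      (form_comm d c ▸ ((hD.tangent_iff hC).mp hDC).1)
  exact h.packing_subset (fun C hC => (hT C hC).elim fun i hi => ⟨q i, ⟨q, .refl, i, rfl⟩, hi⟩) hC

/-! ### Circles tangent to the axis -/

/-- The vector of the `x`-axis. -/
def axisVec : Fin 4 → ℝ := ![0, 0, 0, -1]

/-- The vector of the circle of curvature `s ^ 2` tangent to the axis from above at `t / s`. -/
def ford (s t : ℝ) : Fin 4 → ℝ := ![s ^ 2, t ^ 2, s * t, 1]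

/-- The half of the plane in which the parameters of circles tangent to the axis are normalised. -/
def InHalf (s t : ℝ) : Prop := 0 < s ∨ (s = 0 ∧ t < 0)

theorem InHalf.add {s t s' t' : ℝ} (h : InHalf s t) (h' : InHalf s' t') :
    InHalf (s + s') (t + t') := by
  rcases h with h | ⟨h, h1⟩ <;> rcases h' with h' | ⟨h', h2⟩
  · exact Or.inl (by linarith)
  · exact Or.inl (by linarith)
  · exact Or.inl (by linarith)
  · exact Or.inr ⟨by linarith, by linarith⟩

theorem InHalf.not_neg {s t : ℝ} (h : InHalf s t) : ¬ InHalf (-s) (-t) := by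
  rintro (h' | ⟨h', h1⟩) <;> rcases h with h | ⟨h, h2⟩ <;> linarith

theorem inHalf_or_neg {s t : ℝ} (h : s ≠ 0 ∨ t ≠ 0) : InHalf s t ∨ InHalf (-s) (-t) := by
  unfold InHalf
  rcases lt_trichotomy s 0 with hs | hs | hs
  · exact Or.inr (Or.inl (by linarith))
  · rcases lt_or_gt_of_ne (h.resolve_left (not_not.mpr hs)) with ht | ht
    · exact Or.inl (Or.inr ⟨hs, ht⟩)
    · exact Or.inr (Or.inr ⟨by linarith, by linarith⟩)
  · exact Or.inl (Or.inl hs)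

theorem ford_neg (s t : ℝ) : ford (-s) (-t) = ford s t := by
  simp [ford]

theorem form_axisVec : form axisVec axisVec = 1 := by simp [form, axisVec]

theorem form_axisVec_ford (s t : ℝ) : form axisVec (ford s t) = -1 := by simp [form, axisVec, ford]

theorem form_ford_ford (s t s' t' : ℝ) :
    form (ford s t) (ford s' t') = 1 - (s * t' - s' * t) ^ 2 / 2 := by
  simp [form, ford]; ring

theorem form_ford_self (s t : ℝ) : form (ford s t) (ford s t) = 1 := by
  rw [form_ford_ford]; ring

theorem quadric_ford (s t : ℝ) (z : Plane) :
    quadric (ford s t) z = s ^ 2 * (z 0 ^ 2 + z 1 ^ 2) - 2 * (s * t * z 0 + z 1) + t ^ 2 := by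
  simp [quadric, ford]

theorem represents_xAxis : Represents xAxis axisVec := by
  have h : ∀ z : Plane, quadric axisVec z = 2 * z 1 := fun z => by simp [quadric, axisVec]
  refine ⟨form_axisVec, ?_, ?_⟩ <;> ext z <;>
    simp only [xAxis, line, Set.mem_ofPred_eq, inner_plane, h] <;> simp [mul_neg_iff]

theorem represents_disc (c : Plane) (r : ℝ) (hr : 0 < r) :
    Represents (disc c r hr) (discVec c r) := represents_ball hr rfl rfl

theorem represents_circleX (α : ℝ) (hα : 0 < α) : Represents (circleX α hα) (ford α 0) := by
  have h : discVec !₂[(0 : ℝ), 1 / α ^ 2] (1 / α ^ 2) = ford α 0 := by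
    ext i; fin_cases i <;> simp [discVec, ford]; field_simp
  exact h ▸ represents_disc _ _ _

theorem represents_circleY (α : ℝ) : Represents (circleY α) (ford 1 (2 / α)) := by
  have h : discVec !₂[2 / α, (1 : ℝ)] 1 = ford 1 (2 / α) := by
    ext i; fin_cases i <;> simp [discVec, ford]
  exact h ▸ represents_disc _ _ _

section ford

variable {C D : Circle} {s t s' t' : ℝ}

theorem tangent_ford_iff (hC : Represents C (ford s t)) (hD : Represents D (ford s' t')) :
    Tangent C D ↔ (s * t' - s' * t) ^ 2 = 4 := by
  rw [hC.tangent_iff hD, form_ford_ford]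
  refine ⟨fun h => by linarith [h.1], fun h => ⟨by linarith, Or.inl ?_⟩⟩
  simp only [ford, Matrix.cons_val_zero]
  by_contra hn
  have hs : s = 0 := by nlinarith [sq_nonneg s, sq_nonneg s']
  have hs' : s' = 0 := by nlinarith [sq_nonneg s, sq_nonneg s']
  rw [hs, hs'] at h
  norm_num at h

theorem InHalf.tangent_xAxis (h : InHalf s t) (hC : Represents C (ford s t)) :
    Tangent C xAxis := by
  rw [hC.tangent_iff represents_xAxis, form_comm, form_axisVec_ford]
  refine ⟨rfl, ?_⟩
  simp only [FutureSum, ford, axisVec, Matrix.cons_val_zero, Matrix.cons_val_one, add_zero]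
  rcases h with h | ⟨rfl, h⟩
  · exact Or.inl (by positivity)
  · exact Or.inr ⟨by norm_num, by nlinarith⟩

/-- Tangency to the axis makes the last coordinate 1, and unit norm becomes v₂² = v₀v₁: the
symmetric matrix with these entries has rank one, hence is the square of a vector (s, t). -/
theorem exists_ford_of_tangent_xAxis (h : Tangent C xAxis) :
    ∃ s t, InHalf s t ∧ Represents C (ford s t) := by
  obtain ⟨v, hv⟩ := exists_represents C
  obtain ⟨h1, h2⟩ := (hv.tangent_iff represents_xAxis).mp h
  have hn := hv.1
  simp only [form, axisVec, FutureSum] at h1 h2 hn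
  simp at h1 h2
  rw [h1] at hn
  rcases h2 with h2 | ⟨h2, h3⟩
  · refine ⟨√(v 0), v 2 / √(v 0), Or.inl (Real.sqrt_pos.mpr h2), ?_⟩
    have hs : √(v 0) ≠ 0 := (Real.sqrt_pos.mpr h2).ne'
    have e : v = ford (√(v 0)) (v 2 / √(v 0)) := by
      ext i; fin_cases i
      · simp [ford, Real.sq_sqrt h2.le]
      · simp [ford, div_pow, Real.sq_sqrt h2.le]; field_simp; linarith
      · simp [ford]; field_simp
      · simpa [ford] using h1
    rwa [← e]
  · refine ⟨0, -√(v 1), Or.inr ⟨rfl, by simpa using h3⟩, ?_⟩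
    have hv2 : v 2 = 0 := by rw [h2] at hn; nlinarith
    have e : v = ford 0 (-√(v 1)) := by
      ext i; fin_cases i
      · simp [ford, h2]
      · simp [ford, Real.sq_sqrt h3.le]
      · simp [ford, hv2]
      · simpa [ford] using h1
    rwa [← e]

theorem ford_injective (h : InHalf s t) (h' : InHalf s' t') (e : ford s t = ford s' t') :
    s = s' ∧ t = t' := by
  have e0 : s ^ 2 = s' ^ 2 := congrFun e 0
  have e1 : t ^ 2 = t' ^ 2 := congrFun e 1
  have e2 : s * t = s' * t' := congrFun e 2
  rcases h with h | ⟨rfl, h⟩ <;> rcases h' with h' | ⟨rfl, h'⟩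
  · have : s = s' := by rwa [sq_eq_sq₀ h.le h'.le] at e0
    subst this
    exact ⟨rfl, mul_left_cancel₀ h.ne' e2⟩
  · nlinarith
  · nlinarith
  · exact ⟨rfl, by nlinarith⟩

theorem mem_carrier_inter_xAxis_iff (hC : Represents C (ford s t)) (p : Plane) :
    p ∈ C.carrier ∩ xAxis.carrier ↔ s * p 0 = t ∧ p 1 = 0 := by
  rw [hC.2.1, represents_xAxis.2.1, Set.mem_inter_iff, Set.mem_ofPred_eq, Set.mem_ofPred_eq,
    quadric_ford]
  have h : quadric axisVec p = 2 * p 1 := by simp [quadric, axisVec]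
  rw [h]
  constructor
  · rintro ⟨h1, h2⟩
    have h2 : p 1 = 0 := by linarith
    refine ⟨?_, h2⟩
    rw [h2] at h1
    have : (s * p 0 - t) ^ 2 = 0 := by linarith
    linarith [pow_eq_zero_iff two_ne_zero |>.mp this]
  · rintro ⟨rfl, h2⟩
    rw [h2]; exact ⟨by ring, by ring⟩

/-- For s, s' > 0 this compares t/s with t'/s'. The choice t < 0 when s = 0 makes the determinant
agree with the convention that a line touches the axis at −∞. -/
theorem leftOf_iff (h : InHalf s t) (h' : InHalf s' t') (hC : Represents C (ford s t))
    (hD : Represents D (ford s' t')) : LeftOf C D ↔ 0 < s * t' - s' * t := by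
  unfold LeftOf
  simp only [mem_carrier_inter_xAxis_iff hC, mem_carrier_inter_xAxis_iff hD, hC.isLine_iff,
    hD.isLine_iff, ford, Matrix.cons_val_zero, sq_eq_zero_iff]
  constructor
  · rintro (⟨h1, h2⟩ | ⟨p, ⟨hp, -⟩, q, ⟨hq, -⟩, hpq⟩)
    · subst h1
      have h3 := h'.resolve_right fun h => h2 h.1
      have h4 := (h.resolve_left (lt_irrefl 0)).2
      nlinarith
    · have hs : 0 < s := h.resolve_right fun h0 => by rw [h0.1, zero_mul] at hp; linarith [h0.2]
      have hs' : 0 < s' := h'.resolve_right fun h0 => by rw [h0.1, zero_mul] at hq; linarith [h0.2]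
      rw [← hp, ← hq]
      nlinarith [mul_pos (mul_pos hs hs') (sub_pos.mpr hpq)]
  · intro hdet
    rcases h' with h' | ⟨rfl, h'⟩
    · rcases h with h | ⟨rfl, h⟩
      · refine Or.inr ⟨!₂[t / s, 0], ⟨by simp; field_simp, by simp⟩, !₂[t' / s', 0],
          ⟨by simp; field_simp, by simp⟩, ?_⟩
        simp only [Matrix.cons_val_zero]
        rw [div_lt_div_iff₀ h h']; linarith
      · exact Or.inl ⟨rfl, h'.ne'⟩
    · rcases h with h | ⟨rfl, h⟩
      · nlinarith
      · simp at hdet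

end ford

/-- Solve for a vector with given determinants with two others. -/
theorem cramer {x y x' y' s t d e : ℝ} (hd : s * y' - x' * t = d) (he : x * t - s * y = e) :
    (x * y' - x' * y) * s = d * x + e * x' ∧ (x * y' - x' * y) * t = d * y + e * y' := by
  subst hd he
  constructor <;> ring

theorem eq_two_of_sq {d : ℝ} (h : d ^ 2 = 4) (h0 : 0 < d) : d = 2 := by nlinarith

section middle

variable {x y x' y' s t : ℝ}

/-- By Cramer's rule the new vector is the sum up to sign, and the half-plane normalisation, closed
under addition, excludes the minus sign. -/
theorem eq_add_of_det (hA : InHalf x y) (hB : InHalf x' y') (hC : InHalf s t)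
    (hAB : (x * y' - x' * y) ^ 2 = 4) (h1 : x * t - s * y = 2) (h2 : s * y' - x' * t = 2) :
    s = x + x' ∧ t = y + y' := by
  obtain ⟨e1, e2⟩ := cramer h2 h1
  have : (x * y' - x' * y - 2) * (x * y' - x' * y + 2) = 0 := by linarith
  rcases mul_eq_zero.mp this with h | h
  · have h : x * y' - x' * y = 2 := by linarith
    rw [h] at e1 e2
    exact ⟨by linarith, by linarith⟩
  · have h : x * y' - x' * y = -2 := by linarith
    rw [h] at e1 e2
    refine absurd (hA.add hB) ?_
    have := hC.not_neg
    rwa [show -s = x + x' by linarith, show -t = y + y' by linarith] at this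

theorem eq_sub_of_det (hA : InHalf x y) (hB : InHalf x' y') (hC : InHalf s t)
    (hCB : (s * y' - x' * t) ^ 2 = 4) (h1 : s * y - x * t = 2) (h2 : x * y' - x' * y = 2) :
    s = x - x' ∧ t = y - y' := by
  obtain ⟨e1, e2⟩ := cramer (rfl : s * y' - x' * t = _) (show x * t - s * y = -2 by linarith)
  rw [h2] at e1 e2
  have : (s * y' - x' * t - 2) * (s * y' - x' * t + 2) = 0 := by linarith
  rcases mul_eq_zero.mp this with h | h
  · rw [show s * y' - x' * t = 2 by linarith] at e1 e2
    exact ⟨by linarith, by linarith⟩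
  · rw [show s * y' - x' * t = -2 by linarith] at e1 e2
    refine absurd (hA.add hB) ?_
    have := hC.not_neg
    rwa [show -s = x + x' by linarith, show -t = y + y' by linarith] at this

end middle

/-! ### The vectors with given labels -/

/-- The first parameter of the circle with label `v`. -/
def labelS (α : ℝ) (v : ℤ × ℤ) : ℝ := v.1 * α + v.2

/-- The second parameter of the circle with label `v`. -/
def labelT (α : ℝ) (v : ℤ × ℤ) : ℝ := 2 * v.2 / α

theorem labelS_add (α : ℝ) (v w : ℤ × ℤ) : labelS α (v + w) = labelS α v + labelS α w := by
  simp [labelS]; ring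

theorem labelT_add (α : ℝ) (v w : ℤ × ℤ) : labelT α (v + w) = labelT α v + labelT α w := by
  simp [labelT]; ring

theorem labelS_neg (α : ℝ) (v : ℤ × ℤ) : labelS α (-v) = -labelS α v := by
  simp [labelS]; ring

theorem labelT_neg (α : ℝ) (v : ℤ × ℤ) : labelT α (-v) = -labelT α v := by
  simp [labelT]; ring

theorem labelS_sub (α : ℝ) (v w : ℤ × ℤ) : labelS α (v - w) = labelS α v - labelS α w := by
  simp [labelS]; ring

theorem labelT_sub (α : ℝ) (v w : ℤ × ℤ) : labelT α (v - w) = labelT α v - labelT α w := by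
  simp [labelT]; ring

/-- The parameters (α, 0) and (1, 2/α) of the generators have determinant 2, so tangency on the axis
becomes integer determinant ±1. -/
theorem label_det {α : ℝ} (hα : 0 < α) (v w : ℤ × ℤ) :
    labelS α v * labelT α w - labelS α w * labelT α v = 2 * (v.1 * w.2 - v.2 * w.1 : ℤ) := by
  simp [labelS, labelT]; field_simp; ring

theorem label_injective {α : ℝ} (hα : 0 < α) {v w : ℤ × ℤ} (hs : labelS α v = labelS α w)
    (ht : labelT α v = labelT α w) : v = w := by
  unfold labelS at hs
  unfold labelT at ht
  have h2 : (v.2 : ℝ) = w.2 := by field_simp at ht; linarith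
  have h1 : (v.1 : ℝ) = w.1 := by
    rw [h2] at hs
    exact mul_right_cancel₀ hα.ne' (add_right_cancel hs)
  exact Prod.ext (by exact_mod_cast h1) (by exact_mod_cast h2)

/-- The vector of the circle with label `v`. -/
def labelVec (α : ℝ) (v : ℤ × ℤ) : Fin 4 → ℝ := ford (labelS α v) (labelT α v)

/-- The label `v` is normalised. -/
def LabelPos (α : ℝ) (v : ℤ × ℤ) : Prop := InHalf (labelS α v) (labelT α v)

theorem labelVec_neg (α : ℝ) (v : ℤ × ℤ) : labelVec α (-v) = labelVec α v := by
  rw [labelVec, labelS_neg, labelT_neg, ford_neg]; rfl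

theorem LabelPos.eq {α : ℝ} (hα : 0 < α) {v w : ℤ × ℤ} (hv : LabelPos α v) (hw : LabelPos α w)
    (h : labelVec α v = labelVec α w) : v = w :=
  let ⟨h1, h2⟩ := ford_injective hv hw h
  label_injective hα h1 h2

theorem labelPos_or_neg {α : ℝ} (hα : 0 < α) {v : ℤ × ℤ} (hv : v ≠ 0) :
    LabelPos α v ∨ LabelPos α (-v) := by
  unfold LabelPos
  rw [labelS_neg, labelT_neg]
  apply inHalf_or_neg
  by_contra! h
  exact hv (label_injective hα (by rw [h.1]; simp [labelS]) (by rw [h.2]; simp [labelT]))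

/-- A label determines its circle and, by injectivity on normalised pairs, a circle determines its
label; the recursive rule is therefore consistent. -/
theorem IsLabel.labelPos_and_represents {α : ℝ} {hα : 0 < α} {C : Circle} {v : ℤ × ℤ}
    (h : IsLabel α hα C v) : LabelPos α v ∧ Represents C (labelVec α v) := by
  induction h with
  | baseX =>
    refine ⟨Or.inl (by simpa [labelS] using hα), ?_⟩
    simpa [labelVec, labelS, labelT] using represents_circleX α hα
  | baseY =>
    refine ⟨Or.inl (by simp [labelS]), ?_⟩
    simpa [labelVec, labelS, labelT] using represents_circleY α
  | @middle A B C v w _ _ hm hC h1 h2 ihA ihB =>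
    obtain ⟨hv, hA⟩ := ihA
    obtain ⟨hw, hB⟩ := ihB
    obtain ⟨s, t, hst, hC⟩ := exists_ford_of_tangent_xAxis hC
    rw [leftOf_iff hv hst hA hC] at h1
    rw [leftOf_iff hst hw hC hB] at h2
    obtain ⟨hAB, hBC, hAC⟩ := hm
    rw [tangent_ford_iff hA hB] at hAB
    rw [tangent_ford_iff hB hC] at hBC
    rw [tangent_ford_iff hA hC] at hAC
    obtain ⟨rfl, rfl⟩ := eq_add_of_det hv hw hst hAB (eq_two_of_sq hAC h1)
      (eq_two_of_sq (by linarith) h2)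
    rw [← labelS_add, ← labelT_add] at hst hC
    exact ⟨hst, hC⟩
  | @left A B C v w _ _ hm hC h1 h2 ihA ihB =>
    obtain ⟨hv, hA⟩ := ihA
    obtain ⟨hw, hB⟩ := ihB
    obtain ⟨s, t, hst, hC⟩ := exists_ford_of_tangent_xAxis hC
    rw [leftOf_iff hst hv hC hA] at h1
    rw [leftOf_iff hv hw hA hB] at h2
    obtain ⟨hAB, hBC, hAC⟩ := hm
    rw [tangent_ford_iff hA hB] at hAB
    rw [tangent_ford_iff hB hC] at hBC
    rw [tangent_ford_iff hA hC] at hAC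
    obtain ⟨rfl, rfl⟩ := eq_sub_of_det hv hw hst (by linarith) (eq_two_of_sq (by linarith) h1)
      (eq_two_of_sq hAB h2)
    rw [← labelS_sub, ← labelT_sub] at hst hC
    exact ⟨hst, hC⟩
  | @right A B C v w _ _ hm hC h1 h2 ihA ihB =>
    obtain ⟨hv, hA⟩ := ihA
    obtain ⟨hw, hB⟩ := ihB
    obtain ⟨s, t, hst, hC⟩ := exists_ford_of_tangent_xAxis hC
    rw [leftOf_iff hv hw hA hB] at h1
    rw [leftOf_iff hw hst hB hC] at h2
    obtain ⟨hAB, hBC, hAC⟩ := hm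
    rw [tangent_ford_iff hA hB] at hAB
    rw [tangent_ford_iff hB hC] at hBC
    rw [tangent_ford_iff hA hC] at hAC
    have hAB := eq_two_of_sq hAB h1
    have hBC := eq_two_of_sq hBC h2
    obtain ⟨e1, e2⟩ := cramer (show s * labelT α w - labelS α w * t = -2 by linarith)
      (rfl : labelS α v * t - s * labelT α v = _)
    have hst' : s = labelS α w - labelS α v ∧ t = labelT α w - labelT α v := by
      rw [hAB] at e1 e2
      have : (labelS α v * t - s * labelT α v - 2) * (labelS α v * t - s * labelT α v + 2) = 0 := by
        linarith
      rcases mul_eq_zero.mp this with h | h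
      · rw [show labelS α v * t - s * labelT α v = 2 by linarith] at e1 e2
        exact ⟨by linarith, by linarith⟩
      · rw [show labelS α v * t - s * labelT α v = -2 by linarith] at e1 e2
        refine absurd (hv.add hw) ?_
        have := hst.not_neg
        rwa [show -s = labelS α v + labelS α w by linarith,
          show -t = labelT α v + labelT α w by linarith] at this
    obtain ⟨rfl, rfl⟩ := hst'
    rw [← labelS_sub, ← labelT_sub] at hst hC
    exact ⟨hst, hC⟩

/-! ### Coprime pairs -/

/-- A property of coprime pairs propagates from the standard basis to all of them, if it is even and
inherited by the sum of two pairs of determinant one. -/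
theorem coprime_induction {p : ℤ × ℤ → Prop} (h10 : p (1, 0)) (h01 : p (0, 1))
    (hneg : ∀ v, p v → p (-v))
    (hadd : ∀ v w : ℤ × ℤ, v.1 * w.2 - v.2 * w.1 = 1 → p v → p w → p (v + w))
    {v : ℤ × ℤ} (hv : IsCoprime v.1 v.2) : p v := by
  -- A coprime pair is the first row of a matrix in SL₂(ℤ). Left multiplication by S exchanges the
  -- rows up to sign, and by T adds the second row to the first.
  have key : ∀ g : SL(2, ℤ), p (g 0 0, g 0 1) ∧ p (g 1 0, g 1 1) := by
    intro g
    have hg : g ∈ Subgroup.closure {ModularGroup.S, ModularGroup.T} := by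
      rw [SpecialLinearGroup.SL2Z_generators]; trivial
    induction hg using Subgroup.closure_induction_left with
    | one => simpa using ⟨h10, h01⟩
    | mul_left x hx g _ ih =>
      have hdet := Matrix.det_fin_two g.1 ▸ g.2
      rcases hx with rfl | rfl
      · simpa [ModularGroup.coe_S, Matrix.mul_apply, Fin.sum_univ_two] using
          ⟨hneg _ ih.2, ih.1⟩
      · simpa [ModularGroup.coe_T, Matrix.mul_apply, Fin.sum_univ_two] using
          ⟨hadd _ _ hdet ih.1 ih.2, ih.2⟩
    | inv_mul_cancel x hx g _ ih =>
      have hdet := Matrix.det_fin_two g.1 ▸ g.2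
      rcases hx with rfl | rfl
      · simpa [ModularGroup.coe_S, Matrix.mul_apply, Fin.sum_univ_two,
          Matrix.SpecialLinearGroup.coe_inv, Matrix.adjugate_fin_two] using ⟨ih.2, hneg _ ih.1⟩
      · have h := hadd _ _ (by simp; linarith) (hneg _ ih.2) ih.1
        rw [add_comm] at h
        simpa [ModularGroup.coe_T, Matrix.mul_apply, Fin.sum_univ_two,
          Matrix.SpecialLinearGroup.coe_inv, Matrix.adjugate_fin_two] using ⟨h, ih.2⟩
  obtain ⟨a, b, hab⟩ := hv
  have := (key ⟨!![v.1, v.2; -b, a], by rw [Matrix.det_fin_two_of]; linarith⟩).1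
  simpa using this

theorem isCoprime_of_det {v w : ℤ × ℤ} (h : (v.1 * w.2 - v.2 * w.1) ^ 2 = 1) :
    IsCoprime v.1 v.2 :=
  ⟨(v.1 * w.2 - v.2 * w.1) * w.2, -((v.1 * w.2 - v.2 * w.1) * w.1), by linarith⟩

/-! ### The circles of the packing that are tangent to the axis -/

/-- The quadruple of the axis and the circles with labels `v`, `w`, `v + w`. -/
def labelQuad (α : ℝ) (v w : ℤ × ℤ) : Fin 4 → Fin 4 → ℝ :=
  ![axisVec, labelVec α v, labelVec α w, labelVec α (v + w)]

theorem isQuad_labelQuad {α : ℝ} (hα : 0 < α) {v w : ℤ × ℤ}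
    (h : (v.1 * w.2 - v.2 * w.1) ^ 2 = 1) : IsQuad (labelQuad α v w) := by
  have hdet := label_det hα v w
  have hsq : (labelS α v * labelT α w - labelS α w * labelT α v) ^ 2 = 4 := by
    rw [hdet, mul_pow, ← Int.cast_pow, h]; norm_num
  have h1 : form (labelVec α v) (labelVec α w) = -1 := by
    rw [labelVec, labelVec, form_ford_ford, hsq]; norm_num
  have h2 : form (labelVec α v) (labelVec α (v + w)) = -1 := by
    rw [labelVec, labelVec, form_ford_ford, labelS_add, labelT_add]; linarith
  have h3 : form (labelVec α w) (labelVec α (v + w)) = -1 := by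
    rw [labelVec, labelVec, form_ford_ford, labelS_add, labelT_add]; linarith
  have h0 : ∀ u, form axisVec (labelVec α u) = -1 := fun u => form_axisVec_ford _ _
  have h4 : ∀ u, form (labelVec α u) (labelVec α u) = 1 := fun u => form_ford_self _ _
  intro i j
  fin_cases i <;> fin_cases j <;>
    simp [labelQuad, form_axisVec, h0, h1, h2, h3, h4, form_comm _ axisVec,
      form_comm (labelVec α w) (labelVec α v), form_comm (labelVec α (v + w))]

/-- The vectors are quadratic in the labels, so the parallelogram law computes the swaps away from
the axis: v becomes v + 2w, w becomes 2v + w, and v + w becomes v − w. -/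
theorem exists_labelQuad_of_reach {α : ℝ} {v₀ w₀ : ℤ × ℤ}
    (h₀ : (v₀.1 * w₀.2 - v₀.2 * w₀.1) ^ 2 = 1) {r : Fin 4 → Fin 4 → ℝ}
    (h : Reach {0}ᶜ (labelQuad α v₀ w₀) r) :
    ∃ v w : ℤ × ℤ, (v.1 * w.2 - v.2 * w.1) ^ 2 = 1 ∧ r = labelQuad α v w := by
  induction h with
  | refl => exact ⟨v₀, w₀, h₀, rfl⟩
  | @step r k hk _ ih =>
    obtain ⟨v, w, hvw, rfl⟩ := ih
    have hop : ∀ k : Fin 4, opposite (labelQuad α v w) k = (2 : ℝ) • axisVec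
        + (2 : ℝ) • labelVec α v + (2 : ℝ) • labelVec α w + (2 : ℝ) • labelVec α (v + w)
        - (3 : ℝ) • labelQuad α v w k := by
      intro k
      simp only [opposite, Fin.sum_univ_four, labelQuad, smul_add]; simp
    have e1 : opposite (labelQuad α v w) 1 = labelVec α (v + w + w) := by
      rw [hop]
      ext i; fin_cases i <;>
        simp [labelQuad, labelVec, ford, axisVec, labelS_add, labelT_add] <;> ring
    have e2 : opposite (labelQuad α v w) 2 = labelVec α (v + (v + w)) := by
      rw [hop]
      ext i; fin_cases i <;>
        simp [labelQuad, labelVec, ford, axisVec, labelS_add, labelT_add] <;> ring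
    have e3 : opposite (labelQuad α v w) 3 = labelVec α (v + -w) := by
      rw [hop]
      ext i; fin_cases i <;>
        simp [labelQuad, labelVec, ford, axisVec, labelS_add, labelT_add, labelS_neg,
          labelT_neg] <;> ring
    fin_cases k
    · simp at hk
    -- Signs of labels do not affect the vectors; they are chosen so that the last label is again
    -- the sum of the other two.
    · refine ⟨v + w + w, -w,
        by simp only [Prod.fst_add, Prod.snd_add, Prod.fst_neg, Prod.snd_neg]; linarith, ?_⟩
      funext i; fin_cases i <;> simp [swapAt, labelQuad, labelVec_neg]
      simpa [labelQuad] using e1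
    · refine ⟨-v, v + (v + w),
        by simp only [Prod.fst_add, Prod.snd_add, Prod.fst_neg, Prod.snd_neg]; linarith, ?_⟩
      funext i; fin_cases i <;> simp [swapAt, labelQuad, labelVec_neg]
      simpa [labelQuad] using e2
    · refine ⟨v, -w, by simp only [Prod.fst_neg, Prod.snd_neg]; linarith, ?_⟩
      funext i; fin_cases i <;> simp [swapAt, labelQuad, labelVec_neg]
      simpa [labelQuad] using e3

/-- A circle of the packing is the axis, or tangent to the axis with a vector given by a coprime
pair, or far away from the axis. -/
theorem exists_label_of_mem {α : ℝ} (hα : 0 < α) {C : Circle} (hC : C ∈ halfPlanePacking α hα) :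
    ∃ c, Represents C c ∧ (c = axisVec ∨ (∃ v : ℤ × ℤ, IsCoprime v.1 v.2 ∧ c = labelVec α v) ∨
      form axisVec c ≤ -7) := by
  have hq := isQuad_labelQuad hα (v := (1, 0)) (w := (0, 1)) (by norm_num)
  obtain ⟨c, hc, hCc⟩ := hq.exists_mem_orbit (T := {circleX α hα, circleY α, xAxis}) (by
    rintro C (rfl | rfl | rfl)
    · exact ⟨1, by simpa [labelQuad, labelVec, labelS, labelT] using represents_circleX α hα⟩
    · exact ⟨2, by simpa [labelQuad, labelVec, labelS, labelT] using represents_circleY α⟩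
    · exact ⟨0, represents_xAxis⟩) hC
  refine ⟨c, hCc, ?_⟩
  rcases hq.mem_orbit_compl_or_form_le 0 hc with ⟨r, hr, i, rfl⟩ | h
  · obtain ⟨v, w, hvw, rfl⟩ := exists_labelQuad_of_reach (by norm_num) hr
    have hv := isCoprime_of_det hvw
    have hw : IsCoprime w.1 w.2 := isCoprime_of_det (w := v) (by linarith)
    have hvw' : IsCoprime (v + w).1 (v + w).2 := isCoprime_of_det (w := w)
      (by simp only [Prod.fst_add, Prod.snd_add]; linarith)
    fin_cases i
    · exact Or.inl rfl
    · exact Or.inr (Or.inl ⟨v, hv, rfl⟩)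
    · exact Or.inr (Or.inl ⟨w, hw, rfl⟩)
    · exact Or.inr (Or.inl ⟨v + w, hvw', rfl⟩)
  · exact Or.inr (Or.inr h)

/-- Up to sign, `v` is the label of a circle. -/
def HasLabel (α : ℝ) (hα : 0 < α) (v : ℤ × ℤ) : Prop :=
  ∃ w, (w = v ∨ w = -v) ∧ ∃ C, IsLabel α hα C w

theorem HasLabel.neg {α : ℝ} {hα : 0 < α} {v : ℤ × ℤ} (h : HasLabel α hα v) :
    HasLabel α hα (-v) := by
  obtain ⟨w, hw, h⟩ := h
  exact ⟨w, by rw [neg_neg]; exact hw.symm, h⟩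

/-- The sum is the label of the circle between A and B. Of v − w and w − v one is normalised, and it
labels the circle to the left of A or to the right of B respectively. -/
theorem hasLabel_add_sub {α : ℝ} {hα : 0 < α} {v w : ℤ × ℤ} {A B : Circle}
    (hA : IsLabel α hα A v) (hB : IsLabel α hα B w) (hdet : v.1 * w.2 - v.2 * w.1 = 1) :
    HasLabel α hα (v + w) ∧ HasLabel α hα (v - w) := by
  obtain ⟨hv, hA'⟩ := hA.labelPos_and_represents
  obtain ⟨hw, hB'⟩ := hB.labelPos_and_represents
  have hd := label_det hα v w
  rw [hdet, Int.cast_one, mul_one] at hd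
  have hAB : Tangent A B := (tangent_ford_iff hA' hB').mpr (by rw [hd]; norm_num)
  have hlt : LeftOf A B := (leftOf_iff hv hw hA' hB').mpr (by rw [hd]; norm_num)
  constructor
  · obtain ⟨C, hC⟩ := exists_circle (form_ford_self (labelS α v + labelS α w)
      (labelT α v + labelT α w))
    have h := hv.add hw
    refine ⟨v + w, Or.inl rfl, C, .middle hA hB ⟨hAB, ?_, ?_⟩ (h.tangent_xAxis hC) ?_ ?_⟩
    · rw [tangent_ford_iff hB' hC]; linear_combination (congrArg (· ^ 2) hd)
    · rw [tangent_ford_iff hA' hC]; linear_combination (congrArg (· ^ 2) hd)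
    · rw [leftOf_iff hv h hA' hC]; linarith
    · rw [leftOf_iff h hw hC hB']; linarith
  · have hne : v - w ≠ 0 := by
      intro h
      rw [sub_eq_zero.mp h] at hdet
      linarith
    rcases labelPos_or_neg hα hne with h | h
    · unfold LabelPos at h
      rw [labelS_sub, labelT_sub] at h
      obtain ⟨C, hC⟩ := exists_circle (form_ford_self (labelS α v - labelS α w)
        (labelT α v - labelT α w))
      refine ⟨v - w, Or.inl rfl, C, .left hA hB ⟨hAB, ?_, ?_⟩ (h.tangent_xAxis hC) ?_ hlt⟩
      · rw [tangent_ford_iff hB' hC]; linear_combination (congrArg (· ^ 2) hd)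
      · rw [tangent_ford_iff hA' hC]; linear_combination (congrArg (· ^ 2) hd)
      · rw [leftOf_iff h hv hC hA']; linarith
    · rw [neg_sub] at h
      unfold LabelPos at h
      rw [labelS_sub, labelT_sub] at h
      obtain ⟨C, hC⟩ := exists_circle (form_ford_self (labelS α w - labelS α v)
        (labelT α w - labelT α v))
      refine ⟨w - v, Or.inr (neg_sub v w).symm, C, .right hA hB ⟨hAB, ?_, ?_⟩
        (h.tangent_xAxis hC) hlt ?_⟩
      · rw [tangent_ford_iff hB' hC]; linear_combination (congrArg (· ^ 2) hd)
      · rw [tangent_ford_iff hA' hC]; linear_combination (congrArg (· ^ 2) hd)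
      · rw [leftOf_iff hw h hB' hC]; linarith

theorem HasLabel.add {α : ℝ} {hα : 0 < α} {v w : ℤ × ℤ} (hv : HasLabel α hα v)
    (hw : HasLabel α hα w) (hdet : v.1 * w.2 - v.2 * w.1 = 1) : HasLabel α hα (v + w) := by
  obtain ⟨v', hv', A, hA⟩ := hv
  obtain ⟨w', hw', B, hB⟩ := hw
  -- Changing one sign turns the sum into a difference and reverses the determinant, which
  -- exchanging A and B restores.
  rcases hv' with rfl | rfl <;> rcases hw' with rfl | rfl
  · exact (hasLabel_add_sub hA hB hdet).1
  · have h := (hasLabel_add_sub hB hA (by simp; linarith)).2.neg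
    rwa [neg_sub, sub_neg_eq_add] at h
  · have h := (hasLabel_add_sub hB hA (by simp; linarith)).2
    rwa [sub_neg_eq_add, add_comm] at h
  · have h := (hasLabel_add_sub hA hB (by simp; linarith)).1.neg
    rwa [neg_add, neg_neg, neg_neg] at h

theorem hasLabel_of_isCoprime {α : ℝ} {hα : 0 < α} {v : ℤ × ℤ} (hv : IsCoprime v.1 v.2) :
    HasLabel α hα v :=
  coprime_induction ⟨_, Or.inl rfl, _, .baseX⟩ ⟨_, Or.inl rfl, _, .baseY⟩ (fun _ h => h.neg)
    (fun _ _ hdet h1 h2 => h1.add h2 hdet) hv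

theorem isLabel_of_represents {α : ℝ} {hα : 0 < α} {v : ℤ × ℤ} (hv : IsCoprime v.1 v.2)
    (hpos : LabelPos α v) {C : Circle} (hC : Represents C (labelVec α v)) :
    IsLabel α hα C v := by
  obtain ⟨w, hw, D, hD⟩ := hasLabel_of_isCoprime (hα := hα) hv
  obtain ⟨hwpos, hDw⟩ := hD.labelPos_and_represents
  have hwv : w = v := by
    refine hwpos.eq hα hpos ?_
    rcases hw with rfl | rfl
    · rfl
    · exact labelVec_neg α v
  subst hwv
  rwa [hC.circle_eq hDw]

/-- A closed set of circles that contains the axis and two tangent circles on it contains all the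
circles given by integral combinations with coprime coefficients. -/
theorem ApollonianClosed.mem_of_isCoprime {P : Set Circle} (hP : ApollonianClosed P)
    (hL : xAxis ∈ P) {x y x' y' : ℝ} (hdet : (x * y' - x' * y) ^ 2 = 4) {A B : Circle}
    (hA : A ∈ P) (hB : B ∈ P) (hA' : Represents A (ford x y)) (hB' : Represents B (ford x' y'))
    {v : ℤ × ℤ} (hv : IsCoprime v.1 v.2) {C : Circle}
    (hC : Represents C (ford (v.1 * x + v.2 * x') (v.1 * y + v.2 * y'))) : C ∈ P := by
  have tangent_axis {s t s' t' : ℝ} (h : (s * t' - s' * t) ^ 2 = 4) {D : Circle}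
      (hD : Represents D (ford s t)) : Tangent D xAxis := by
    have : s ≠ 0 ∨ t ≠ 0 := by
      by_contra! h0
      rw [h0.1, h0.2] at h
      norm_num at h
    rcases inHalf_or_neg this with h' | h'
    · exact h'.tangent_xAxis hD
    · exact h'.tangent_xAxis (by rwa [ford_neg])
  refine coprime_induction
    (p := fun v => ∃ C ∈ P, Represents C (ford (v.1 * x + v.2 * x') (v.1 * y + v.2 * y')))
    ⟨A, hA, by simpa using hA'⟩ ⟨B, hB, by simpa using hB'⟩ ?_ ?_ hv |>.elim
    fun D hD => hC.circle_eq hD.2 ▸ hD.1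
  · rintro v ⟨D, hD, hD'⟩
    refine ⟨D, hD, ?_⟩
    rw [← ford_neg] at hD'
    convert hD' using 2 <;> simp <;> ring
  · rintro v w hvw ⟨D, hD, hD'⟩ ⟨E, hE, hE'⟩
    have hvw' : (v.1 * w.2 - v.2 * w.1 : ℝ) = 1 := by exact_mod_cast hvw
    obtain ⟨F, hF⟩ := exists_circle (form_ford_self
      ((v + w).1 * x + (v + w).2 * x') ((v + w).1 * y + (v + w).2 * y'))
    have d1 : ((v.1 * x + v.2 * x') * (w.1 * y + w.2 * y')
        - (w.1 * x + w.2 * x') * (v.1 * y + v.2 * y')) ^ 2 = 4 := by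
      linear_combination (v.1 * w.2 - v.2 * w.1 + 1 : ℝ) * (x * y' - x' * y) ^ 2 * hvw' + hdet
    have d2 : ((v.1 * x + v.2 * x') * ((v + w).1 * y + (v + w).2 * y')
        - ((v + w).1 * x + (v + w).2 * x') * (v.1 * y + v.2 * y')) ^ 2 = 4 := by
      push_cast [Prod.fst_add, Prod.snd_add]; linarith
    have d3 : ((w.1 * x + w.2 * x') * ((v + w).1 * y + (v + w).2 * y')
        - ((v + w).1 * x + (v + w).2 * x') * (w.1 * y + w.2 * y')) ^ 2 = 4 := by
      push_cast [Prod.fst_add, Prod.snd_add]; linarith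
    have d4 : (((v + w).1 * x + (v + w).2 * x') * (v.1 * y + v.2 * y')
        - (v.1 * x + v.2 * x') * ((v + w).1 * y + (v + w).2 * y')) ^ 2 = 4 := by linarith
    have d5 : (((v + w).1 * x + (v + w).2 * x') * (w.1 * y + w.2 * y')
        - (w.1 * x + w.2 * x') * ((v + w).1 * y + (v + w).2 * y')) ^ 2 = 4 := by linarith
    refine ⟨F, hP D hD E hE xAxis hL F ⟨?_, tangent_axis d3 hE', tangent_axis d1 hD'⟩ ?_ ?_
      (tangent_axis d4 hF), hF⟩
    · rwa [tangent_ford_iff hD' hE']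
    · rwa [tangent_ford_iff hF hD']
    · rwa [tangent_ford_iff hF hE']

theorem mem_halfPlanePacking_of_represents {α : ℝ} (hα : 0 < α) {v : ℤ × ℤ}
    (hv : IsCoprime v.1 v.2) {C : Circle} (hC : Represents C (labelVec α v)) :
    C ∈ halfPlanePacking α hα := by
  refine (apollonianClosed_packing _).mem_of_isCoprime (subset_packing _ (by simp)) ?_
    (subset_packing _ (by simp)) (subset_packing _ (by simp)) (represents_circleX α hα)
    (represents_circleY α) hv ?_
  · field_simp; norm_num
  · convert hC using 1
    unfold labelVec labelS labelT
    congr 1 <;> ring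

/-! ### Similarities that preserve the axis -/

theorem mem_xAxis_carrier (z : Plane) : z ∈ xAxis.carrier ↔ z 1 = 0 := by
  simp [xAxis, line, inner_plane]

theorem mem_xAxis_interior (z : Plane) : z ∈ xAxis.interior ↔ z 1 < 0 := by
  simp [xAxis, line, inner_plane]

theorem dist_axisMap {ε μ : ℝ} (t : ℝ) (hε : ε ^ 2 = 1) (hμ : 0 < μ) (z w : Plane) :
    dist (!₂[ε * μ * z 0 + t, μ * z 1] : Plane) !₂[ε * μ * w 0 + t, μ * w 1] = μ * dist z w := by
  rw [← sq_eq_sq₀ dist_nonneg (by positivity), mul_pow, dist_sq_eq, dist_sq_eq]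
  simp only [Matrix.cons_val_zero, Matrix.cons_val_one]
  linear_combination μ ^ 2 * (z 0 - w 0) ^ 2 * hε

/-- The similarity `(x, y) ↦ (ε μ x + t, μ y)` with `ε = ± 1`. -/
def axisMap (ε μ t : ℝ) (hε : ε ^ 2 = 1) (hμ : 0 < μ) : Plane ≃ᵈ Plane where
  toFun z := !₂[ε * μ * z 0 + t, μ * z 1]
  invFun z := !₂[ε * (z 0 - t) / μ, z 1 / μ]
  left_inv z := plane_ext
    (by simp only [Matrix.cons_val_zero]; field_simp; linear_combination μ * z 0 * hε)
    (by simp [hμ.ne'])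
  right_inv z := plane_ext
    (by simp only [Matrix.cons_val_zero]; field_simp; linear_combination (z 0 - t) * hε)
    (by simp; field_simp)
  edist_eq' := by
    refine ⟨⟨μ, hμ.le⟩, fun h => hμ.ne' (congrArg NNReal.toReal h), fun z w => ?_⟩
    rw [edist_dist, edist_dist, dist_axisMap t hε hμ, ENNReal.ofReal_mul hμ.le,
      ENNReal.ofReal_eq_coe_nnreal hμ.le]
    rfl

theorem axisMap_apply {ε μ t : ℝ} (hε : ε ^ 2 = 1) (hμ : 0 < μ) (z : Plane) :
    axisMap ε μ t hε hμ z = !₂[ε * μ * z 0 + t, μ * z 1] := rfl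

theorem axisMap_xAxis {ε μ t : ℝ} (hε : ε ^ 2 = 1) (hμ : 0 < μ) :
    xAxis.map (axisMap ε μ t hε hμ) = xAxis := by
  ext z <;> obtain ⟨w, rfl⟩ := (axisMap ε μ t hε hμ).surjective z
  · rw [map_carrier, (axisMap ε μ t hε hμ).injective.mem_set_image, mem_xAxis_carrier,
      mem_xAxis_carrier, axisMap_apply]
    simp [hμ.ne']
  · rw [map_interior, (axisMap ε μ t hε hμ).injective.mem_set_image, mem_xAxis_interior,
      mem_xAxis_interior, axisMap_apply]
    simp [mul_neg_iff, hμ, hμ.not_gt]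

theorem orientationPreserving_axisMap_iff {ε μ t : ℝ} (hε : ε ^ 2 = 1) (hμ : 0 < μ) :
    OrientationPreserving (axisMap ε μ t hε hμ) ↔ ε = 1 := by
  constructor
  · rintro ⟨m, hm, A, hA, b, h⟩
    have hdet : A 0 0 * A 1 1 - A 0 1 * A 1 0 = 1 := by
      rw [← Matrix.det_fin_two]; exact (Matrix.mem_specialOrthogonalGroup_iff.mp hA).2
    have key : ∀ z : Plane, ε * μ * z 0 + t = m * (A 0 0 * z 0 + A 0 1 * z 1) + b 0 ∧
        μ * z 1 = m * (A 1 0 * z 0 + A 1 1 * z 1) + b 1 := by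
      intro z
      have hz := h z
      rw [axisMap_apply] at hz
      have h0 := congrArg (fun z : Plane => z 0) hz
      have h1 := congrArg (fun z : Plane => z 1) hz
      simp [Matrix.toLpLin_apply] at h0 h1
      exact ⟨h0, h1⟩
    have h0 := key 0
    have h1 := key !₂[1, 0]
    have h2 := key !₂[0, 1]
    simp at h0 h1 h2
    have e1 : ε * μ = m * A 0 0 := by linarith [h0.1, h1.1]
    have e2 : m * A 1 0 = 0 := by linarith [h0.2, h1.2]
    have e3 : μ = m * A 1 1 := by linarith [h0.2, h2.2]
    -- The determinant of the linear part, computed from both descriptions up to the sign ε.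
    have e4 : ε * μ ^ 2 = m ^ 2 := by
      linear_combination μ * e1 + m * A 0 0 * e3 + m ^ 2 * hdet + m * A 0 1 * e2
    have hpos : 0 < ε := by
      by_contra hn
      nlinarith [sq_pos_of_pos hm, mul_nonneg (neg_nonneg.mpr (not_lt.mp hn)) (sq_nonneg μ)]
    nlinarith
  · rintro rfl
    refine ⟨μ, hμ, 1, one_mem _, !₂[t, 0], fun z => ?_⟩
    rw [axisMap_apply]
    exact plane_ext (by simp) (by simp)

theorem represents_map_disc {Φ : Plane ≃ᵈ Plane} {μ : ℝ} (hμ : 0 < μ)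
    (h : ∀ z w, dist (Φ z) (Φ w) = μ * dist z w) (c : Plane) {r : ℝ} (hr : 0 < r) :
    Represents ((disc c r hr).map Φ) (discVec (Φ c) (μ * r)) := by
  refine represents_ball (mul_pos hμ hr) ?_ ?_ <;> ext z <;> obtain ⟨w, rfl⟩ := Φ.surjective z
  · simp only [map_carrier, disc, Φ.injective.mem_set_image, Metric.mem_sphere, h,
      mul_right_inj' hμ.ne']
  · simp only [map_interior, disc, Φ.injective.mem_set_image, Metric.mem_ball, h,
      mul_lt_mul_iff_right₀ hμ]

theorem discVec_injective {c c' : Plane} {r r' : ℝ} (hr : 0 < r) (hr' : 0 < r')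
    (h : discVec c r = discVec c' r') : c = c' ∧ r = r' := by
  have h0 : 1 / r = 1 / r' := congrFun h 0
  have h2 : c 0 / r = c' 0 / r' := congrFun h 2
  have h3 : c 1 / r = c' 1 / r' := congrFun h 3
  have : r = r' := by field_simp at h0; exact h0.symm
  subst this
  exact ⟨plane_ext (by field_simp at h2; exact h2) (by field_simp at h3; exact h3), rfl⟩

theorem discVec_eq_ford {s : ℝ} (hs : s ≠ 0) (t : ℝ) :
    discVec !₂[t / s, 1 / s ^ 2] (1 / s ^ 2) = ford s t := by
  ext i; fin_cases i <;> simp [discVec, ford] <;> field_simp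

theorem ratio_pos (Φ : Plane ≃ᵈ Plane) : (0 : ℝ) < Dilation.ratio Φ := by
  exact_mod_cast Dilation.ratio_pos Φ

/-- A similarity that fixes the axis and the two generating circles is the identity. -/
theorem eq_refl_of_fixed {β : ℝ} {hβ : 0 < β} {Θ : Plane ≃ᵈ Plane}
    (hL : Θ '' xAxis.carrier = xAxis.carrier) (hX : (circleX β hβ).map Θ = circleX β hβ)
    (hY : (circleY β).map Θ = circleY β) : Θ = DilationEquiv.refl Plane := by
  have hρ := ratio_pos Θ
  have hd : ∀ z w, dist (Θ z) (Θ w) = Dilation.ratio Θ * dist z w := Dilation.dist_eq Θ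
  have hr : (0 : ℝ) < 1 / β ^ 2 := by positivity
  have fixX := (represents_map_disc hρ hd !₂[(0 : ℝ), 1 / β ^ 2] hr)
  rw [show disc !₂[(0 : ℝ), 1 / β ^ 2] (1 / β ^ 2) hr = circleX β hβ from rfl, hX] at fixX
  obtain ⟨hx, -⟩ := discVec_injective (mul_pos hρ hr) hr (fixX.vec_eq (represents_disc _ _ hr))
  have fixY := (represents_map_disc hρ hd !₂[2 / β, (1 : ℝ)] one_pos)
  rw [show disc !₂[2 / β, (1 : ℝ)] 1 one_pos = circleY β from rfl, hY] at fixY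
  obtain ⟨hy, h1⟩ := discVec_injective (mul_pos hρ one_pos) one_pos
    (fixY.vec_eq (represents_disc _ _ one_pos))
  rw [mul_one] at h1
  simp only [h1, one_mul] at hd
  have h0 : Θ 0 = 0 := by
    have hmem : Θ 0 ∈ (circleX β hβ).carrier ∩ xAxis.carrier := by
      rw [← hX, ← hL]
      refine ⟨Set.mem_image_of_mem _ ?_, Set.mem_image_of_mem _ ?_⟩
      · exact ((mem_carrier_inter_xAxis_iff (represents_circleX β hβ) 0).mpr (by simp)).1
      · rw [mem_xAxis_carrier]; rfl
    rw [mem_carrier_inter_xAxis_iff (represents_circleX β hβ)] at hmem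
    exact plane_ext ((mul_eq_zero.mp hmem.1).resolve_left hβ.ne') hmem.2
  ext1 z
  -- Θ is an isometry fixing three non-collinear points, the origin and the two centres; the
  -- distances to them determine z.
  have e0 := congrArg (· ^ 2) (hd z 0)
  have e1 := congrArg (· ^ 2) (hd z !₂[(0 : ℝ), 1 / β ^ 2])
  have e2 := congrArg (· ^ 2) (hd z !₂[2 / β, (1 : ℝ)])
  simp only [h0, hx, hy, dist_sq_eq] at e0 e1 e2
  simp only [Matrix.cons_val_zero, Matrix.cons_val_one, PiLp.zero_apply] at e0 e1 e2
  have f1 : Θ z 1 = z 1 := by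
    have : 1 / β ^ 2 * (Θ z 1 - z 1) = 0 := by linarith
    linarith [(mul_eq_zero.mp this).resolve_left hr.ne']
  have f0 : Θ z 0 = z 0 := by
    rw [f1] at e0 e2
    have : 2 / β * (Θ z 0 - z 0) = 0 := by linarith
    linarith [(mul_eq_zero.mp this).resolve_left (by positivity)]
  exact plane_ext f0 f1

theorem eq_of_map_eq {β : ℝ} {hβ : 0 < β} {Φ Ψ : Plane ≃ᵈ Plane}
    (hΦ : Φ '' xAxis.carrier = xAxis.carrier) (hΨ : Ψ '' xAxis.carrier = xAxis.carrier)
    (hX : (circleX β hβ).map Φ = (circleX β hβ).map Ψ)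
    (hY : (circleY β).map Φ = (circleY β).map Ψ) : Φ = Ψ := by
  have h : Φ.trans Ψ.symm = DilationEquiv.refl Plane := by
    refine eq_refl_of_fixed (hβ := hβ) ?_ ?_ ?_
    · change (Ψ.symm ∘ Φ) '' _ = _
      rw [Set.image_comp, hΦ, ← hΨ, Set.image_image, hΨ, funext Ψ.symm_apply_apply, Set.image_id']
    · rw [← map_map, hX, map_symm_map]
    · rw [← map_map, hY, map_symm_map]
  ext1 z
  have := DFunLike.congr_fun h z
  simpa [DilationEquiv.symm_apply_eq] using this

theorem circleX_tangent_xAxis (β : ℝ) (hβ : 0 < β) : Tangent (circleX β hβ) xAxis :=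
  InHalf.tangent_xAxis (Or.inl hβ) (represents_circleX β hβ)

theorem circleY_tangent_xAxis (β : ℝ) : Tangent (circleY β) xAxis :=
  InHalf.tangent_xAxis (Or.inl one_pos) (represents_circleY β)

theorem circleX_tangent_circleY (β : ℝ) (hβ : 0 < β) : Tangent (circleX β hβ) (circleY β) := by
  rw [tangent_ford_iff (represents_circleX β hβ) (represents_circleY β)]
  field_simp; norm_num

theorem ne_zero_of_isCoprime {v : ℤ × ℤ} (h : IsCoprime v.1 v.2) : v ≠ 0 := by
  rintro rfl
  exact not_isCoprime_zero_zero h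

/-- The product −1 with the axis excludes the axis itself (product 1) and the far circles (product
at most −7). -/
theorem exists_isLabel_of_tangent {α : ℝ} {hα : 0 < α} {C : Circle}
    (hC : C ∈ halfPlanePacking α hα) (h : Tangent C xAxis) : ∃ v, IsLabel α hα C v := by
  obtain ⟨c, hc, hc'⟩ := exists_label_of_mem hα hC
  have hf := ((hc.tangent_iff represents_xAxis).mp h).1
  rw [form_comm] at hf
  rcases hc' with rfl | ⟨v, hv, rfl⟩ | hc'
  · rw [form_axisVec] at hf; norm_num at hf
  · rcases labelPos_or_neg hα (ne_zero_of_isCoprime hv) with hpos | hpos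
    · exact ⟨v, isLabel_of_represents hv hpos hc⟩
    · exact ⟨-v, isLabel_of_represents hv.neg_neg hpos (by rwa [labelVec_neg])⟩
  · linarith

/-- A line of the packing is the axis, or `α` is rational. -/
theorem eq_xAxis_or_exists_of_isLine {α : ℝ} {hα : 0 < α} {C : Circle}
    (hC : C ∈ halfPlanePacking α hα) (h : C.IsLine) :
    C = xAxis ∨ ∃ v : ℤ × ℤ, IsCoprime v.1 v.2 ∧ labelS α v = 0 ∧ Represents C (labelVec α v) := by
  obtain ⟨c, hc, hc'⟩ := exists_label_of_mem hα hC
  have h0 := hc.isLine_iff.mp h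
  rcases hc' with rfl | ⟨v, hv, rfl⟩ | hc'
  · exact Or.inl (hc.circle_eq represents_xAxis)
  · exact Or.inr ⟨v, hv, pow_eq_zero_iff two_ne_zero |>.mp h0, hc⟩
  -- For a line the product with the axis is minus one coordinate of a unit normal, hence at least
  -- −1.
  · have hn := hc.1
    simp [form, h0, axisVec] at hn hc'
    nlinarith [sq_nonneg (c 2)]

/-! ### Similarities between packings and the labels of their generators -/

section axisSimilarities

variable {α β : ℝ} {hα : 0 < α} {hβ : 0 < β}

theorem isLine_xAxis : xAxis.IsLine := represents_xAxis.isLine_iff.mpr (by simp [axisVec])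

theorem map_mem_halfPlanePacking {Φ : Plane ≃ᵈ Plane}
    (hΦ : mapPacking Φ (halfPlanePacking β hβ) = halfPlanePacking α hα) {C : Circle}
    (hC : C ∈ halfPlanePacking β hβ) : C.map Φ ∈ halfPlanePacking α hα :=
  hΦ ▸ ⟨C, hC, rfl⟩

theorem xAxis_mem (α : ℝ) (hα : 0 < α) : xAxis ∈ halfPlanePacking α hα :=
  subset_packing _ (by simp)

/-- Only the curve is preserved by assumption; that the lower side stays the interior follows from
the packing, since any other line in it has s = 0 and, passing through the origin, would have t = 0
as well. -/
theorem map_xAxis_eq {Φ : Plane ≃ᵈ Plane} (hΦ : Φ ∈ axisSimilarities α β hα hβ) :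
    xAxis.map Φ = xAxis := by
  refine (eq_xAxis_or_exists_of_isLine (map_mem_halfPlanePacking hΦ.2 (xAxis_mem β hβ))
    ((isLine_map_iff _ _).mpr isLine_xAxis)).resolve_right ?_
  rintro ⟨v, hv, hs, hr⟩
  have h0 : (0 : Plane) ∈ (xAxis.map Φ).carrier := by
    rw [map_carrier, hΦ.1, mem_xAxis_carrier]; rfl
  rw [hr.2.1, Set.mem_ofPred_eq, labelVec, quadric_ford] at h0
  have ht : labelT α v = 0 := by simpa using h0
  exact ne_zero_of_isCoprime hv (label_injective hα (by rw [hs]; simp [labelS])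
    (by rw [ht]; simp [labelT]))

theorem labelS_of_map_disc {Φ : Plane ≃ᵈ Plane} {c : Plane} {r : ℝ} {hr : 0 < r} {v : ℤ × ℤ}
    (h : IsLabel α hα ((disc c r hr).map Φ) v) :
    0 < labelS α v ∧ labelS α v ^ 2 * (Dilation.ratio Φ * r) = 1 := by
  obtain ⟨hpos, h⟩ := h.labelPos_and_represents
  have e := (represents_map_disc (ratio_pos Φ) (Dilation.dist_eq Φ) c hr).vec_eq h
  have e0 : 1 / (Dilation.ratio Φ * r) = labelS α v ^ 2 := congrFun e 0
  have hρ := mul_pos (ratio_pos Φ) hr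
  refine ⟨hpos.resolve_right fun h0 => ?_, ?_⟩
  · rw [h0.1] at e0
    have := one_div_pos.mpr hρ
    rw [e0] at this
    norm_num at this
  · rw [← e0]; exact one_div_mul_cancel hρ.ne'

/-- The similarity whose label matrix has the rows `v` and `w`. -/
theorem exists_axisSimilarity (hα : 0 < α) (hβ : 0 < β) {v w : ℤ × ℤ}
    (hdet : (v.1 * w.2 - v.2 * w.1) ^ 2 = 1) (hratio : labelS α v = β * labelS α w)
    (hpos : 0 < labelS α w) :
    ∃ Φ ∈ axisSimilarities α β hα hβ, IsLabel α hα ((circleX β hβ).map Φ) v ∧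
      IsLabel α hα ((circleY β).map Φ) w ∧
      (OrientationPreserving Φ ↔ v.1 * w.2 - v.2 * w.1 = 1) := by
  obtain ⟨d, hd⟩ : ∃ d, d = v.1 * w.2 - v.2 * w.1 := ⟨_, rfl⟩
  have hlab := label_det hα v w
  rw [← hd] at hdet hlab ⊢
  have hε : (d : ℝ) ^ 2 = 1 := by exact_mod_cast hdet
  have hvpos : 0 < labelS α v := hratio ▸ mul_pos hβ hpos
  have hv : IsCoprime v.1 v.2 := isCoprime_of_det (w := w) (by rw [← hd, hdet])
  have hw : IsCoprime w.1 w.2 := isCoprime_of_det (w := v) (by rw [← hdet, hd]; ring)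
  have hμ : 0 < 1 / labelS α w ^ 2 := by positivity
  -- The unit circle `Y_β` must get radius 1/s², with s = `labelS α w`; the origin goes to the
  -- tangency point of the circle labelled v; the determinant decides whether left and right are
  -- exchanged.
  let Φ := axisMap d (1 / labelS α w ^ 2) (labelT α v / labelS α v) hε hμ
  have hΦ : ∀ x y, dist (Φ x) (Φ y) = 1 / labelS α w ^ 2 * dist x y := dist_axisMap _ hε hμ
  have hX : Represents ((circleX β hβ).map Φ) (labelVec α v) := by
    have h := represents_map_disc hμ hΦ !₂[(0 : ℝ), 1 / β ^ 2] (r := 1 / β ^ 2) (by positivity)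
    have e1 : 1 / labelS α w ^ 2 * (1 / β ^ 2) = 1 / labelS α v ^ 2 := by
      rw [hratio]; field_simp
    have e2 : Φ !₂[(0 : ℝ), 1 / β ^ 2] = !₂[labelT α v / labelS α v, 1 / labelS α v ^ 2] := by
      refine plane_ext ?_ ?_
      · simp [Φ, axisMap_apply]
      · simp only [Φ, axisMap_apply, Matrix.cons_val_one]; exact e1
    rwa [e1, e2, discVec_eq_ford hvpos.ne'] at h
  have hY : Represents ((circleY β).map Φ) (labelVec α w) := by
    have h := represents_map_disc hμ hΦ !₂[2 / β, (1 : ℝ)] one_pos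
    have e2 : Φ !₂[2 / β, (1 : ℝ)] = !₂[labelT α w / labelS α w, 1 / labelS α w ^ 2] := by
      refine plane_ext ?_ ?_
      · simp only [Φ, axisMap_apply, Matrix.cons_val_zero]
        rw [hratio] at hlab ⊢
        field_simp
        linear_combination -hlab
      · simp [Φ, axisMap_apply]
    rwa [mul_one, e2, discVec_eq_ford hpos.ne'] at h
  have hL : xAxis.map Φ = xAxis := axisMap_xAxis hε hμ
  refine ⟨Φ, ⟨congrArg Circle.carrier hL, ?_⟩, isLabel_of_represents hv (Or.inl hvpos) hX,
    isLabel_of_represents hw (Or.inl hpos) hY,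
    (orientationPreserving_axisMap_iff hε hμ).trans (by norm_cast)⟩
  apply subset_antisymm
  · rw [halfPlanePacking, mapPacking_packing]
    refine (apollonianClosed_packing _).packing_subset ?_
    rintro _ ⟨C, rfl | rfl | rfl, rfl⟩
    · exact mem_halfPlanePacking_of_represents hα hv hX
    · exact mem_halfPlanePacking_of_represents hα hw hY
    · rw [hL]; exact xAxis_mem α hα
  -- The coefficients below are the rows of the inverse matrix, d times the adjugate: they express
  -- (1, 0) and (0, 1) through v and w.
  · have hcl : ApollonianClosed (mapPacking Φ (halfPlanePacking β hβ)) :=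
      (apollonianClosed_packing _).mapPacking Φ
    have hLm : xAxis ∈ mapPacking Φ (halfPlanePacking β hβ) := ⟨xAxis, xAxis_mem β hβ, hL⟩
    have hdet4 : (labelS α v * labelT α w - labelS α w * labelT α v) ^ 2 = 4 := by
      rw [hlab, mul_pow, hε]; norm_num
    have hd' : (d : ℝ) = v.1 * w.2 - v.2 * w.1 := by rw [hd]; push_cast; rfl
    refine hcl.packing_subset ?_
    rintro _ (rfl | rfl | rfl)
    · refine hcl.mem_of_isCoprime hLm hdet4 ⟨_, subset_packing _ (by simp), rfl⟩
        ⟨_, subset_packing _ (by simp), rfl⟩ hX hY (v := (d * w.2, -(d * v.2)))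
        ⟨v.1, w.1, by linear_combination hdet - d * hd⟩ ?_
      convert represents_circleX α hα using 2
      · push_cast [labelS]; linear_combination α * hε - α * d * hd'
      · push_cast [labelT]; ring
    · refine hcl.mem_of_isCoprime hLm hdet4 ⟨_, subset_packing _ (by simp), rfl⟩
        ⟨_, subset_packing _ (by simp), rfl⟩ hX hY (v := (-(d * w.1), d * v.1))
        ⟨v.2, w.2, by linear_combination hdet - d * hd⟩ ?_
      convert represents_circleY α using 2
      · push_cast [labelS]; linear_combination hε - d * hd'
      · push_cast [labelT]; field_simp; linear_combination hε - d * hd'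
    · exact hLm

theorem eq_of_isLabel {Φ Ψ : Plane ≃ᵈ Plane} (hΦ : Φ ∈ axisSimilarities α β hα hβ)
    (hΨ : Ψ ∈ axisSimilarities α β hα hβ) {v w : ℤ × ℤ}
    (hX : IsLabel α hα ((circleX β hβ).map Φ) v) (hY : IsLabel α hα ((circleY β).map Φ) w)
    (hX' : IsLabel α hα ((circleX β hβ).map Ψ) v) (hY' : IsLabel α hα ((circleY β).map Ψ) w) :
    Φ = Ψ :=
  eq_of_map_eq hΦ.1 hΨ.1
    (hX.labelPos_and_represents.2.circle_eq hX'.labelPos_and_represents.2)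
    (hY.labelPos_and_represents.2.circle_eq hY'.labelPos_and_represents.2)

/-- The labels of the images of the generating circles. -/
theorem exists_labels {Φ : Plane ≃ᵈ Plane} (hΦ : Φ ∈ axisSimilarities α β hα hβ) :
    ∃ v w : ℤ × ℤ, (v.1 * w.2 - v.2 * w.1) ^ 2 = 1 ∧ labelS α v = β * labelS α w ∧
      0 < labelS α w ∧ IsLabel α hα ((circleX β hβ).map Φ) v ∧
      IsLabel α hα ((circleY β).map Φ) w ∧
      (OrientationPreserving Φ ↔ v.1 * w.2 - v.2 * w.1 = 1) := by
  have hL := map_xAxis_eq hΦ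
  have tangent_axis {C : Circle} (h : Tangent C xAxis) : Tangent (C.map Φ) xAxis := by
    rw [← hL, tangent_map_iff]; exact h
  obtain ⟨v, hv⟩ := exists_isLabel_of_tangent
    (map_mem_halfPlanePacking hΦ.2 (subset_packing _ (by simp)))
    (tangent_axis (circleX_tangent_xAxis β hβ))
  obtain ⟨w, hw⟩ := exists_isLabel_of_tangent
    (map_mem_halfPlanePacking hΦ.2 (subset_packing _ (by simp)))
    (tangent_axis (circleY_tangent_xAxis β))
  obtain ⟨hvpos, hv2⟩ := labelS_of_map_disc hv
  obtain ⟨hwpos, hw2⟩ := labelS_of_map_disc hw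
  -- With ρ the ratio of Φ, the image circles have curvatures β²/ρ and 1/ρ, which are the squares of
  -- the two parameters s.
  have hratio : labelS α v = β * labelS α w := by
    rw [← sq_eq_sq₀ hvpos.le (by positivity), mul_pow]
    have hρ := ratio_pos Φ
    field_simp at hv2
    rw [mul_one] at hw2
    have : Dilation.ratio Φ * (labelS α v ^ 2 - β ^ 2 * labelS α w ^ 2) = 0 := by
      linear_combination hv2 - β ^ 2 * hw2
    linarith [(mul_eq_zero.mp this).resolve_left hρ.ne']
  have hdet : (v.1 * w.2 - v.2 * w.1) ^ 2 = 1 := by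
    have h := (tangent_ford_iff hv.labelPos_and_represents.2 hw.labelPos_and_represents.2).mp
      ((tangent_map_iff Φ _ _).mpr (circleX_tangent_circleY β hβ))
    rw [label_det hα, mul_pow] at h
    have h' : ((v.1 * w.2 - v.2 * w.1 : ℤ) : ℝ) ^ 2 = 1 := by linarith
    exact_mod_cast h'
  -- The explicit similarity with the same labels must equal Φ, so its orientation is that of Φ.
  obtain ⟨Ψ, hΨ, hX, hY, hO⟩ := exists_axisSimilarity hα hβ hdet hratio hwpos
  obtain rfl := eq_of_isLabel hΦ hΨ hv hw hX hY
  exact ⟨v, w, hdet, hratio, hwpos, hv, hw, hO⟩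

end axisSimilarities

/-! ### Label matrices -/

/-- The rows of the matrix satisfy the equation of the theorem and are normalised. -/
def IsNormalized (α β : ℝ) (M : GL (Fin 2) ℤ) : Prop :=
  labelS α (M 0 0, M 0 1) = β * labelS α (M 1 0, M 1 1) ∧ 0 < labelS α (M 1 0, M 1 1)

theorem det_sq (M : GL (Fin 2) ℤ) : (M 0 0 * M 1 1 - M 0 1 * M 1 0) ^ 2 = 1 := by
  have h : IsUnit (M : Matrix (Fin 2) (Fin 2) ℤ).det := M.isUnit.map Matrix.detMonoidHom
  rw [Matrix.det_fin_two] at h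
  exact Int.isUnit_sq h

theorem mk_eq_mk_iff_eq_or_neg {M N : GL (Fin 2) ℤ} :
    Matrix.ProjGenLinGroup.mk M = Matrix.ProjGenLinGroup.mk N ↔
      N = M ∨ ∀ i j, N i j = -M i j := by
  rw [Matrix.ProjGenLinGroup.mk_eq_mk_iff]
  constructor
  · rintro ⟨u, rfl⟩
    rcases Int.units_eq_one_or u with rfl | rfl
    · left; simp
    · right; intro i j
      fin_cases j <;> simp [Matrix.mul_apply]
  · rintro (rfl | h)
    · exact ⟨1, by simp⟩
    · refine ⟨-1, ?_⟩
      ext i j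
      fin_cases j <;> simp [h, Matrix.mul_apply]

theorem mk_mem_range_toPGL_iff (M : GL (Fin 2) ℤ) : Matrix.ProjGenLinGroup.mk M ∈
    (Matrix.ProjectiveSpecialLinearGroup.toPGL (n := Fin 2) (R := ℤ)).range ↔
      M 0 0 * M 1 1 - M 0 1 * M 1 0 = 1 := by
  rw [← Matrix.det_fin_two (M : Matrix (Fin 2) (Fin 2) ℤ)]
  constructor
  · rintro ⟨g, hg⟩
    induction g using QuotientGroup.induction_on with | H A =>
    have hA := A.2
    change Matrix.ProjGenLinGroup.mk (Matrix.SpecialLinearGroup.toGL A) = _ at hg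
    rw [mk_eq_mk_iff_eq_or_neg] at hg
    rcases hg with rfl | hg
    · exact hA
    · rw [Matrix.det_fin_two, hg, hg, hg, hg, ← hA, Matrix.det_fin_two]
      simp
  · intro h
    refine ⟨QuotientGroup.mk (⟨M, h⟩ : SL(2, ℤ)), ?_⟩
    change Matrix.ProjGenLinGroup.mk (Matrix.SpecialLinearGroup.toGL _) = _
    congr 1
    ext i j; rfl

section

variable {α β : ℝ} {hα : 0 < α} {hβ : 0 < β}

theorem exists_isNormalized (hβ : 0 < β) {g : PGL(2, ℤ)} (hg : g ∈ moebiusElements α β) :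
    ∃ M : GL (Fin 2) ℤ, Matrix.ProjGenLinGroup.mk M = g ∧ IsNormalized α β M := by
  obtain ⟨M, rfl, hM⟩ := hg
  -- A zero denominator would give the quotient the value 0, while β is positive.
  have hne : (M 1 0 : ℝ) * α + (M 1 1 : ℝ) ≠ 0 := by
    intro h
    rw [h, div_zero] at hM
    exact hβ.ne hM
  rw [div_eq_iff hne] at hM
  rcases lt_or_gt_of_ne hne with h | h
  · refine ⟨M * .scalar (Fin 2) (-1), by simp, ?_⟩
    simp only [IsNormalized, labelS]
    simp [Matrix.mul_apply]
    constructor <;> linarith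
  · exact ⟨M, rfl, hM, h⟩

theorem IsNormalized.mem_moebiusElements {M : GL (Fin 2) ℤ} (h : IsNormalized α β M) :
    Matrix.ProjGenLinGroup.mk M ∈ moebiusElements α β :=
  ⟨M, rfl, (div_eq_iff h.2.ne').mpr h.1⟩

/-- Of a matrix and its negative only one has a positive denominator cα + d. -/
theorem IsNormalized.eq_of_mk_eq {M N : GL (Fin 2) ℤ} (hM : IsNormalized α β M)
    (hN : IsNormalized α β N)
    (h : Matrix.ProjGenLinGroup.mk M = Matrix.ProjGenLinGroup.mk N) : M = N := by
  rcases mk_eq_mk_iff_eq_or_neg.mp h with h | h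
  · exact h.symm
  · have h2 := hM.2
    have h3 := hN.2
    simp only [labelS, h] at h2 h3
    push_cast at h3
    linarith

theorem isLabelMatrix_iff_eq {Φ : Plane ≃ᵈ Plane} {M : Matrix (Fin 2) (Fin 2) ℤ}
    (h : IsLabelMatrix α β hα hβ Φ M) (N : Matrix (Fin 2) (Fin 2) ℤ) :
    IsLabelMatrix α β hα hβ Φ N ↔ N = M := by
  refine ⟨fun h' => ?_, fun h' => h' ▸ h⟩
  have unique {C : Circle} {v w : ℤ × ℤ} (hv : IsLabel α hα C v) (hw : IsLabel α hα C w) :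
      v = w := by
    obtain ⟨hv, hv'⟩ := hv.labelPos_and_represents
    obtain ⟨hw, hw'⟩ := hw.labelPos_and_represents
    exact hv.eq hα hw (hv'.vec_eq hw')
  have h1 := Prod.ext_iff.mp (unique h'.1 h.1)
  have h2 := Prod.ext_iff.mp (unique h'.2 h.2)
  ext i j; fin_cases i <;> fin_cases j
  · exact h1.1
  · exact h1.2
  · exact h2.1
  · exact h2.2

theorem exists_labelMatrix {Φ : Plane ≃ᵈ Plane} (hΦ : Φ ∈ axisSimilarities α β hα hβ) :
    ∃ M : GL (Fin 2) ℤ, IsNormalized α β M ∧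
      IsLabelMatrix α β hα hβ Φ (M : Matrix (Fin 2) (Fin 2) ℤ) ∧
      (OrientationPreserving Φ ↔ M 0 0 * M 1 1 - M 0 1 * M 1 0 = 1) := by
  obtain ⟨v, w, hdet, hratio, hpos, hX, hY, hO⟩ := exists_labels hΦ
  have hu : IsUnit (!![v.1, v.2; w.1, w.2] : Matrix (Fin 2) (Fin 2) ℤ).det := by
    rw [Matrix.det_fin_two_of]
    exact IsUnit.of_pow_eq_one hdet two_ne_zero
  exact ⟨Matrix.GeneralLinearGroup.mk'' _ hu, ⟨hratio, hpos⟩, ⟨hX, hY⟩, hO⟩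

/-! ### Möbius equivalence, also for similarities that move the axis -/

/-- Two rational numbers are equivalent under `SL₂(ℤ)`. -/
theorem exists_moebius_of_rational {v w : ℤ × ℤ} (hv : IsCoprime v.1 v.2)
    (hw : IsCoprime w.1 w.2) (hv0 : labelS α v = 0) (hw0 : labelS β w = 0) :
    ∃ a b c d : ℤ, a * d - b * c = 1 ∧ ((a : ℝ) * α + b) / ((c : ℝ) * α + d) = β := by
  obtain ⟨p, q, hpq⟩ := hv
  obtain ⟨p', q', hpq'⟩ := hw
  unfold labelS at hv0 hw0
  have hpqr : (p * v.1 + q * v.2 : ℝ) = 1 := by exact_mod_cast hpq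
  have hpqr' : (p' * w.1 + q' * w.2 : ℝ) = 1 := by exact_mod_cast hpq'
  have hk : q * α - p ≠ 0 := by
    intro hk
    have : (1 : ℝ) = 0 := by linear_combination -hpqr - v.1 * hk + q * hv0
    norm_num at this
  have hw1 : (w.1 : ℝ) ≠ 0 := by
    intro h
    rw [h] at hw0 hpqr'
    have : (1 : ℝ) = 0 := by linear_combination -hpqr' + q' * hw0
    norm_num at this
  -- The matrix with rows (q, −p) and v has determinant 1 and sends α to ∞, as the one with rows
  -- (q', −p') and w does with β. The matrix here is the inverse of the second times the first.
  refine ⟨w.2 * q + p' * v.1, -(w.2 * p) + p' * v.2, -(w.1 * q) + q' * v.1, w.1 * p + q' * v.2,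
    ?_, ?_⟩
  · linear_combination (p * v.1 + q * v.2) * hpq' + hpq
  · have hden : ((-(w.1 * q) + q' * v.1 : ℤ) : ℝ) * α + ((w.1 * p + q' * v.2 : ℤ) : ℝ)
        = -w.1 * (q * α - p) := by
      push_cast; linear_combination q' * hv0
    rw [hden, div_eq_iff (mul_ne_zero (neg_ne_zero.mpr hw1) hk)]
    push_cast
    linear_combination p' * hv0 + (q * α - p) * hw0

/-- The adjugate inverts the transformation for either sign of the determinant, since scalars act
trivially. -/
theorem moebius_symm {a b c d : ℤ} (hdet : (a * d - b * c) ^ 2 = 1) (hβ : 0 < β)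
    (h : ((a : ℝ) * α + b) / ((c : ℝ) * α + d) = β) :
    ((d : ℝ) * β + (-b : ℤ)) / (((-c : ℤ) : ℝ) * β + a) = α := by
  have hne : (c : ℝ) * α + d ≠ 0 := by
    intro h0
    rw [h0, div_zero] at h
    exact hβ.ne h
  rw [div_eq_iff hne] at h
  have hdet' : (a * d - b * c : ℝ) ^ 2 = 1 := by exact_mod_cast hdet
  have hne' : ((-c : ℤ) : ℝ) * β + a ≠ 0 := by
    intro h0
    push_cast at h0
    have : (a * d - b * c : ℝ) = 0 := by linear_combination (c * α + d) * h0 - c * h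
    rw [this] at hdet'
    norm_num at hdet'
  rw [div_eq_iff hne']
  push_cast
  linear_combination -h

theorem exists_axisSimilarity_of_moebius (hα : 0 < α) (hβ : 0 < β) {a b c d : ℤ}
    (hdet : (a * d - b * c) ^ 2 = 1) (h : ((a : ℝ) * α + b) / ((c : ℝ) * α + d) = β) :
    ∃ Φ ∈ axisSimilarities α β hα hβ, (OrientationPreserving Φ ↔ a * d - b * c = 1) := by
  have hne : (c : ℝ) * α + d ≠ 0 := by
    intro h0
    rw [h0, div_zero] at h
    exact hβ.ne h
  rw [div_eq_iff hne] at h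
  rcases lt_or_gt_of_ne hne with hlt | hgt
  · obtain ⟨Φ, hΦ, -, -, hO⟩ := exists_axisSimilarity (v := (-a, -b)) (w := (-c, -d)) hα hβ
      (by linarith) (by simp only [labelS]; push_cast; linarith)
      (by simp only [labelS]; push_cast; linarith)
    exact ⟨Φ, hΦ, by rw [hO]; ring_nf⟩
  · obtain ⟨Φ, hΦ, -, -, hO⟩ := exists_axisSimilarity (v := (a, b)) (w := (c, d)) hα hβ hdet h hgt
    exact ⟨Φ, hΦ, hO⟩

/-- If the axis is preserved, the inverse of the label matrix serves. Otherwise each packing has a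
line besides its axis, so α and β are rational and determinant 1 is available whatever the
orientation of Φ. -/
theorem moebius_of_mapPacking {Φ : Plane ≃ᵈ Plane}
    (hΦ : mapPacking Φ (halfPlanePacking α hα) = halfPlanePacking β hβ) :
    ∃ a b c d : ℤ, (a * d - b * c = 1 ∨ a * d - b * c = -1 ∧ ¬ OrientationPreserving Φ) ∧
      ((a : ℝ) * α + b) / ((c : ℝ) * α + d) = β := by
  by_cases hL : xAxis.map Φ = xAxis
  · obtain ⟨v, w, hdet, hratio, hpos, -, -, hO⟩ :=
      exists_labels (α := β) (β := α) (hα := hβ) (hβ := hα) ⟨congrArg Circle.carrier hL, hΦ⟩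
    refine ⟨w.2, -v.2, -w.1, v.1, ?_, moebius_symm hdet hα ((div_eq_iff hpos.ne').mpr hratio)⟩
    have e : w.2 * v.1 - -v.2 * -w.1 = v.1 * w.2 - v.2 * w.1 := by ring
    rw [e, hO]
    rcases sq_eq_one_iff.mp hdet with h | h
    · exact Or.inl h
    · exact Or.inr ⟨h, by rw [h]; norm_num⟩
  · have hL' : xAxis.map Φ.symm ≠ xAxis := fun h => hL (by
      conv_lhs => rw [← h]
      exact map_map_symm Φ _)
    obtain ⟨w, hw, hw0, -⟩ := (eq_xAxis_or_exists_of_isLine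
      (map_mem_halfPlanePacking hΦ (xAxis_mem α hα))
      ((isLine_map_iff _ _).mpr isLine_xAxis)).resolve_left hL
    obtain ⟨v, hv, hv0, -⟩ := (eq_xAxis_or_exists_of_isLine
      (map_mem_halfPlanePacking (mapPacking_symm_eq hΦ) (xAxis_mem β hβ))
      ((isLine_map_iff _ _).mpr isLine_xAxis)).resolve_left hL'
    obtain ⟨a, b, c, d, h1, h2⟩ := exists_moebius_of_rational hv hw hv0 hw0
    exact ⟨a, b, c, d, Or.inl h1, h2⟩

end

end Apollonian

end

/-! ### The theorem -/

theorem theorem1 (α β : ℝ) (hα : 0 < α) (hβ : 0 < β) :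
    (∃ e : Apollonian.axisSimilarities α β hα hβ ≃ Apollonian.moebiusElements α β,
      ∀ Φ : Apollonian.axisSimilarities α β hα hβ,
        (∃ M : GL (Fin 2) ℤ,
          (∀ N : Matrix (Fin 2) (Fin 2) ℤ,
            Apollonian.IsLabelMatrix α β hα hβ (Φ : Apollonian.Plane ≃ᵈ Apollonian.Plane) N ↔
              N = (M : Matrix (Fin 2) (Fin 2) ℤ)) ∧
          (e Φ : PGL(2, ℤ)) = Matrix.ProjGenLinGroup.mk M) ∧
        (Apollonian.OrientationPreserving (Φ : Apollonian.Plane ≃ᵈ Apollonian.Plane) ↔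
          (e Φ : PGL(2, ℤ)) ∈
            (Matrix.ProjectiveSpecialLinearGroup.toPGL (n := Fin 2) (R := ℤ)).range)) ∧
    (Apollonian.Similar (Apollonian.halfPlanePacking α hα) (Apollonian.halfPlanePacking β hβ) ↔
      ∃ a b c d : ℤ, (a * d - b * c = 1 ∨ a * d - b * c = -1) ∧
        ((a : ℝ) * α + b) / ((c : ℝ) * α + d) = β) ∧
    (Apollonian.OrientedSimilar (Apollonian.halfPlanePacking α hα)
        (Apollonian.halfPlanePacking β hβ) ↔
      ∃ a b c d : ℤ, a * d - b * c = 1 ∧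
        ((a : ℝ) * α + b) / ((c : ℝ) * α + d) = β) := by
  open Apollonian in
  refine ⟨?_, ?_, ?_⟩
  · choose M hM hlabel hO using
      fun Φ : axisSimilarities α β hα hβ => exists_labelMatrix Φ.2
    let f : axisSimilarities α β hα hβ → moebiusElements α β :=
      fun Φ => ⟨Matrix.ProjGenLinGroup.mk (M Φ), (hM Φ).mem_moebiusElements⟩
    have hf : Function.Bijective f := by
      constructor
      · intro Φ Ψ h
        have hMM : M Φ = M Ψ := (hM Φ).eq_of_mk_eq (hM Ψ) (congrArg Subtype.val h)
        have h1 := hlabel Φ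
        have h2 := hlabel Ψ
        rw [← hMM] at h2
        exact Subtype.ext (eq_of_isLabel Φ.2 Ψ.2 h1.1 h1.2 h2.1 h2.2)
      · rintro ⟨g, hg⟩
        obtain ⟨N, rfl, hN⟩ := exists_isNormalized hβ hg
        obtain ⟨Φ, hΦ, hX, hY, -⟩ := exists_axisSimilarity hα hβ (det_sq N) hN.1 hN.2
        refine ⟨⟨Φ, hΦ⟩, Subtype.ext ?_⟩
        have h := (isLabelMatrix_iff_eq (hlabel ⟨Φ, hΦ⟩) (N : Matrix (Fin 2) (Fin 2) ℤ)).mp ⟨hX, hY⟩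
        exact congrArg Matrix.ProjGenLinGroup.mk (Units.ext h).symm
    refine ⟨Equiv.ofBijective f hf, fun Φ => ⟨⟨M Φ, isLabelMatrix_iff_eq (hlabel Φ), rfl⟩, ?_⟩⟩
    exact (hO Φ).trans (mk_mem_range_toPGL_iff (M Φ)).symm
  · constructor
    · rintro ⟨Φ, hΦ⟩
      obtain ⟨a, b, c, d, h, h'⟩ := moebius_of_mapPacking hΦ
      exact ⟨a, b, c, d, h.imp_right And.left, h'⟩
    · rintro ⟨a, b, c, d, h, h'⟩
      have hdet : (a * d - b * c) ^ 2 = 1 := by rcases h with h | h <;> rw [h] <;> norm_num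
      -- Similarity asks for a map from the packing of α to that of β, so the two parameters trade
      -- places and the matrix is inverted.
      obtain ⟨Φ, hΦ, -⟩ := exists_axisSimilarity_of_moebius hβ hα (by linarith)
        (moebius_symm hdet hβ h')
      exact ⟨Φ, hΦ.2⟩
  · constructor
    · rintro ⟨Φ, hO, hΦ⟩
      obtain ⟨a, b, c, d, h, h'⟩ := moebius_of_mapPacking hΦ
      exact ⟨a, b, c, d, h.resolve_right fun h => h.2 hO, h'⟩
    · rintro ⟨a, b, c, d, h, h'⟩
      obtain ⟨Φ, hΦ, hO⟩ := exists_axisSimilarity_of_moebius hβ hα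
        (by linear_combination (a * d - b * c + 1) * h) (moebius_symm (by rw [h]; norm_num) hβ h')
      exact ⟨Φ, hO.mpr (by linarith), hΦ.2⟩
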